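/- **Theorem (Crash faults, arbitrary initial configuration).** There is an absolute constant $C$ such that the following holds. Let $G$ be a connected simple graph with $n$ anonymous, memoryless nodes, $m$ edges and maximum degree $\Delta$, the edges at each node $v$ being labelled by ports $1,\dots,\deg v$ independently of the labels at the other nodes. Let $k\le n$ robots with distinct identifiers $1,\dots,k$ be placed arbitrarily on the nodes of $G$, let $l$ be the number of nodes that are occupied initially (clusters), and let at most $f\le k$ of the robots crash, each at an arbitrary time; a crashed robot vanishes with its memory. The robots know $m,\Delta,k,f,l$. In each synchronous round every robot that has not crashed or terminated reads the memories of all robots at its node, computes, and may leave through a port; it learns the port through which it enters the next node. Then the deterministic algorithm below achieves dispersion within $C\,(f+l)\cdot\min(m,k\Delta,k^2)$ rounds: from then on all robots that have not crashed have terminated, do not move, and are at pairwise distinct nodes. Each robot uses at most $C\,(1+\log_2(k+\Delta))$ bits of memory, its identifier included (for $k+\Delta = 0$ the logarithm is read as $0$). *Algorithm (phased, priority-based cluster DFS).* There are $l+f$ phases of $8\min(m,k\Delta,k^2)$ rounds each; after them all robots terminate. A robot that has settled never moves again. At the start of a phase all pointers of all robots are reset to null, and the unsettled robots at a node form a cluster,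 whose identifier $cid$ and priority is the largest identifier of its members. During the phase, at each node only the unsettled cluster with the largest $cid$ present acts, provided it is not waiting; the other unsettled robots at the node wait until the phase ends. Let $c$ be the $cid$ of the acting cluster and $e$ the port through which it entered (null at the start of the phase). - If no settled robot is at the node, the member $r$ with the lowest identifier settles and the cluster takes possession of the node: $r.cid=c$, $r.parent=e$, and $r.cdr$ is the least port other than $r.parent$. The others leave through $r.cdr$. - If a settled robot $r$ with $r.cid$ null or $<c$ is there, the cluster takes possession of the node in the same way (no robot settles) and leaves through $r.cdr$. - If a settled robot $r$ with $r.cid>c$ is there, the cluster waits until the phase ends. - If a settled robot $r$ with $r.cid=c$ is there: if $e\notin\{r.parent,r.cdr\}$, the cluster leaves through $e$ and changes nothing; otherwise, if $r$'s backtrack flag is set, it leaves through $r.parent$, and if not, $r.cdr$ advances to the next larger port other than $r.parent$ and the cluster leaves through it. Whenever $r.cdr$ is to be set and no port is left, the backtrack flag of $r$ is set, $r.cdr$ becomes $r.parent$, and the cluster leaves through it; if $r.parent$ is null, the cluster waits until the phase ends. -/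

import Mathlib

namespace Dispersion

/-! ### The model: port-labelled graphs, robots, crashes, synchronous rounds -/

/-- A port labelling: the edges at each node `v` are numbered `0, …, deg v - 1`, the numberings at
different nodes being unrelated. -/
abbrev PortLabelling {V : Type*} (G : SimpleGraph V) [G.LocallyFinite] : Type _ :=
  ∀ v : V, G.neighborSet v ≃ Fin (G.degree v)

/-- A deterministic algorithm for `k` robots with identifiers `Fin k`, local communication and
finite memory.

In each round an active robot communicates and computes (`compute`): it is given the degree of the
node at which it is, the memories of all robots at that node (indexed by identifier, `none` for the
robots that are not there), and its own identifier. It returns its new memory and the port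
through which it leaves, `none` if it stays. Then it moves; a robot that has moved records in its
memory the port through which it entered the new node (`arrive`). A robot whose memory satisfies
`halted` has terminated. Nodes have no names and no memory. -/
structure RobotAlgorithm (k : ℕ) where
  State : Type
  [fintypeState : Fintype State]
  init : Fin k → State
  halted : State → Bool
  compute : (degree : ℕ) → (view : Fin k → Option State) → (self : Fin k) → State × Option ℕ
  arrive : ℕ → State → State

/-- The number of bits that a robot stores: its identifier and its memory. -/
def RobotAlgorithm.memoryBits {k : ℕ} (A : RobotAlgorithm k) : ℕ :=
  letI := A.fintypeState
  Nat.clog 2 (k * Fintype.card A.State)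

/-- A configuration: the position and the memory of each robot. -/
structure Config {k : ℕ} (A : RobotAlgorithm k) (V : Type*) where
  pos : Fin k → V
  mem : Fin k → A.State

/-- Crash pattern `crash`: robot `i` takes part in the rounds `t < crash i` and has vanished from
round `crash i` on; `crash i = ⊤` means that it never crashes. -/
def Alive {k : ℕ} (crash : Fin k → ℕ∞) (t : ℕ) (i : Fin k) : Prop := (t : ℕ∞) < crash i

section Execution

variable {V : Type*} [Fintype V] [DecidableEq V] {G : SimpleGraph V} [DecidableRel G.Adj]
  {k : ℕ} (A : RobotAlgorithm k) (port : PortLabelling G) (crash : Fin k → ℕ∞)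

open Classical in
/-- What the robots at the node `v` read in round `t`: the memories of the robots at `v` that have
not crashed. -/
noncomputable def view (t : ℕ) (c : Config A V) (v : V) : Fin k → Option A.State :=
  fun j => if Alive crash t j ∧ c.pos j = v then some (c.mem j) else none

/-- A robot at `v` with memory `s` leaves through port `o`; it stays if `o` is `none` (or not a port
of `v`). -/
def move (v : V) (s : A.State) (o : Option ℕ) : V × A.State :=
  match o with
  | none => (v, s)
  | some p =>
    if h : p < G.degree v then
      let e := (port v).symm ⟨p, h⟩
      (e.1, A.arrive (port e.1 ⟨v, SimpleGraph.Adj.symm e.2⟩) s)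
    else (v, s)

open Classical in
/-- What round `t` does to robot `i`. Crashed and terminated robots do nothing. -/
noncomputable def robotStep (t : ℕ) (c : Config A V) (i : Fin k) : V × A.State :=
  if Alive crash t i ∧ A.halted (c.mem i) = false then
    let r := A.compute (G.degree (c.pos i)) (view A crash t c (c.pos i)) i
    move A port (c.pos i) r.1 r.2
  else (c.pos i, c.mem i)

/-- The configuration after `t` rounds, the robots starting at the nodes `start`. -/
noncomputable def run (start : Fin k → V) : ℕ → Config A V
  | 0 => ⟨start, A.init⟩
  | t + 1 =>
    let c := run start t
    ⟨fun i => (robotStep A port crash t c i).1, fun i => (robotStep A port crash t c i).2⟩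

/-- Fault-tolerant dispersion is achieved within `T` rounds: from then on, all robots that have not
crashed have terminated, stay where they are, and are at pairwise distinct nodes. -/
def DispersedWithin (start : Fin k → V) (T : ℕ) : Prop :=
  ∀ t, T ≤ t →
    (∀ i, Alive crash t i →
      A.halted ((run A port crash start t).mem i) = true ∧
      (run A port crash start t).pos i = (run A port crash start T).pos i) ∧
    (∀ i j, Alive crash t i → Alive crash t j →
      (run A port crash start t).pos i = (run A port crash start t).pos j → i = j)

end Execution

/-! ### The phased, priority-based cluster DFS algorithm -/

/-- What the robots know: the number `m` of edges, the maximum degree `Δ`, the number `k` of robots,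
the bound `f` on the number of crashes, the number `l` of initial clusters. -/
structure Params where
  m : ℕ
  Δ : ℕ
  k : ℕ
  f : ℕ
  l : ℕ

/-- The number of rounds of a phase. -/
def Params.phaseLength (P : Params) : ℕ := 8 * min P.m (min (P.k * P.Δ) (P.k ^ 2))

/-- The algorithm runs for `l + f` phases. -/
def Params.totalRounds (P : Params) : ℕ := (P.l + P.f) * P.phaseLength

/-- The memory of a robot.
* `clock`: the number of rounds that have passed. It encodes the number of phases completed and the
  countdown within the phase.
* `settled`: whether the robot has settled. A settled robot never moves again.
* `cid`: the identifier, and at the same time the priority, of the cluster to which the robot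
  belongs, or, if it is settled, of the cluster to which its node belongs; `⊥` is null.
* `parent`, `cdr`, `B`: the pointers of a settled robot: the port through which its cluster first
  entered its node, the port through which it last left in the DFS, and whether all ports of the
  node are done (backtrack flag).
* `entry`: the port through which an unsettled robot entered the node where it is (null at the start
  of a phase).
* `waiting`: whether an unsettled robot waits for the end of the phase. -/
structure Mem (P : Params) where
  clock : Fin (P.totalRounds + 1)
  settled : Bool
  cid : WithBot (Fin P.k)
  parent : Option (Fin P.Δ)
  cdr : Option (Fin P.Δ)
  B : Bool
  entry : Option (Fin P.Δ)
  waiting : Bool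

namespace Mem

variable {P : Params}

/-- A memory as a tuple of its fields. -/
def equivTuple (P : Params) : Mem P ≃
    Fin (P.totalRounds + 1) × Bool × Option (Fin P.k) × Option (Fin P.Δ) × Option (Fin P.Δ) ×
      Bool × Option (Fin P.Δ) × Bool where
  toFun s := (s.clock, s.settled, s.cid, s.parent, s.cdr, s.B, s.entry, s.waiting)
  invFun x := ⟨x.1, x.2.1, x.2.2.1, x.2.2.2.1, x.2.2.2.2.1, x.2.2.2.2.2.1, x.2.2.2.2.2.2.1,
    x.2.2.2.2.2.2.2⟩
  left_inv _ := rfl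
  right_inv _ := rfl

instance : Fintype (Mem P) := Fintype.ofEquiv _ (equivTuple P).symm

/-- The initial memory of every robot. -/
def initial (P : Params) : Mem P := ⟨0, false, ⊥, none, none, false, none, false⟩

/-- One round has passed. -/
def tick (s : Mem P) : Mem P :=
  { s with clock := ⟨min (s.clock + 1) P.totalRounds, by omega⟩ }

/-- The reset at the start of a phase. Unsettled robots join the cluster `c`; settled robots get
null pointers. -/
def reset (c : WithBot (Fin P.k)) (s : Mem P) : Mem P :=
  { s with
    cid := if s.settled then ⊥ else c
    parent := none
    cdr := none
    B := false
    entry := none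
    waiting := false }

end Mem

section Algorithm

variable {P : Params}

/-- The largest identifier among the unsettled robots in a view. -/
def maxUnsettledId (w : Fin P.k → Option (Mem P)) : WithBot (Fin P.k) :=
  Finset.univ.sup fun j => if (w j).any (fun s => !s.settled) then (j : WithBot (Fin P.k)) else ⊥

/-- At the start of a phase, everything is reset and the unsettled robots at a node form a cluster,
whose identifier is the largest identifier of a member. In the other rounds the memories are taken
as they are. -/
def refresh (clock : ℕ) (w : Fin P.k → Option (Mem P)) : Fin P.k → Option (Mem P) :=
  if clock % P.phaseLength = 0 then fun j => (w j).map (Mem.reset (maxUnsettledId w)) else w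

/-- The highest priority among the unsettled robots at a node. -/
def topPriority (w : Fin P.k → Option (Mem P)) : WithBot (Fin P.k) :=
  Finset.univ.sup fun j => match w j with
    | some s => if s.settled then ⊥ else s.cid
    | none => ⊥

/-- The exploring robot with the lowest identifier at a node: unsettled, not waiting, in the cluster
with the highest priority at the node. -/
def explorer (w : Fin P.k → Option (Mem P)) : Option (Fin P.k × Mem P) :=
  (List.finRange P.k).findSome? fun j => match w j with
    | some s => if !s.settled && !s.waiting && s.cid == topPriority w then some (j, s) else none
    | none => none

/-- The robot that is settled at a node. -/
def settler (w : Fin P.k → Option (Mem P)) : Option (Fin P.k × Mem P) :=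
  (List.finRange P.k).findSome? fun j => match w j with
    | some s => if s.settled then some (j, s) else none
    | none => none

/-- The least port `p ≥ q` of a node of degree `d` that is not the parent port. -/
def nextPort (d : ℕ) (parent : Option (Fin P.Δ)) (q : ℕ) : Option (Fin P.Δ) :=
  (List.finRange P.Δ).find? fun p => decide (q ≤ p.val) && decide (p.val < d) && (some p != parent)

/-- The DFS continues at the node of the settled robot `s` with the least port `p ≥ q` other than
the parent port. If there is none, it sets the backtrack flag and continues with the parent port. -/
def advance (d : ℕ) (q : ℕ) (s : Mem P) : Mem P :=
  match nextPort d s.parent q with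
  | some p => { s with cdr := some p, B := false }
  | none => { s with cdr := s.parent, B := true }

/-- The cluster `c`, which came in through port `e`, takes possession of a node where `s` settles or
is settled. -/
def claim (d : ℕ) (c : WithBot (Fin P.k)) (e : Option (Fin P.Δ)) (s : Mem P) : Mem P :=
  advance d 0 { s with settled := true, cid := c, parent := e, entry := none, waiting := false }

/-- What a cluster does at a node: robot `owner` is or becomes the settled robot of the node, with
new memory `mem`, and the rest of the cluster leaves through `exit`. -/
structure Plan (P : Params) where
  owner : Fin P.k
  mem : Mem P
  exit : Option (Fin P.Δ)

/-- The plan of the exploring cluster at a node of degree `d`; `none` if there is no exploring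
cluster or if the node belongs to a cluster of higher priority. -/
def plan (d : ℕ) (w : Fin P.k → Option (Mem P)) : Option (Plan P) :=
  match explorer w with
  | none => none
  | some (r, x) =>
    match settler w with
    | none =>
      let s' := claim d x.cid x.entry x
      some ⟨r, s', s'.cdr⟩
    | some (o, s) =>
      if x.cid < s.cid then none
      else if s.cid < x.cid then
        let s' := claim d x.cid x.entry s
        some ⟨o, s', s'.cdr⟩
      else if x.entry = s.parent ∨ x.entry = s.cdr then
        if s.B then some ⟨o, s, s.parent⟩
        else
          let s' := advance d (s.cdr.elim 0 fun p => p.val + 1) s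
          some ⟨o, s', s'.cdr⟩
      else some ⟨o, s, x.entry⟩

/-- The new memory and the exit port of robot `i` with (refreshed) memory `s`, given the plan `π`
and the highest priority `c` at its node. An unsettled robot that is not of the exploring cluster,
or whose cluster has to stop, waits. -/
def execute (π : Option (Plan P)) (c : WithBot (Fin P.k)) (i : Fin P.k) (s : Mem P) :
    Mem P × Option ℕ :=
  match π with
  | none => if s.settled then (s, none) else ({ s with waiting := true }, none)
  | some π =>
    if i = π.owner then (π.mem, none)
    else if s.settled || s.waiting then (s, none)
    else match π.exit with
      | none => ({ s with waiting := true }, none)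
      | some p => if s.cid = c then (s, some p.val) else ({ s with waiting := true }, none)

/-- The computation of robot `i` in one round. -/
def computeRound (d : ℕ) (w : Fin P.k → Option (Mem P)) (i : Fin P.k) : Mem P × Option ℕ :=
  match w i with
  | none => (Mem.initial P, none)
  | some s₀ =>
    let w' := refresh s₀.clock w
    match w' i with
    | none => (Mem.initial P, none)
    | some s =>
      let r := execute (plan d w') (topPriority w') i s
      (r.1.tick, r.2)

/-- The phased, priority-based cluster DFS algorithm with knowledge `P`. -/
def clusterDFS (P : Params) : RobotAlgorithm P.k where
  State := Mem P
  init := fun _ => Mem.initial P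
  halted := fun s => s.clock.val == P.totalRounds
  compute := computeRound
  arrive := fun p s => { s with entry := if h : p < P.Δ then some ⟨p, h⟩ else none }

end Algorithm

end Dispersion

set_option linter.unusedSectionVars false

/-! The proof rests on a potential argument over phases and on an analysis of the search of one
cluster.

In a phase without crashes, the cluster with the largest identifier among all unsettled robots
settles completely (`top_cluster_settles`). No other cluster can stop it or take a node from it, and
a node held by a weaker cluster looks unvisited to it; so it performs an undisturbed depth-first
search (`top_plan`, `ptrAt_succ`). The search recognises tree edges locally: on arrival through a
tree edge back to a parent, the entry port is the `cdr` of the node, whereas on arrival at a visited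
node through a non-tree edge it is neither `parent` nor `cdr` (`Core.not_tree_edge`). Every directed
edge is tried at most once, at the cost of one move out and one move back. The nodes visited carry
distinct settled robots, fewer than `k` as long as a robot is unsettled, so at most `2 * μ` directed
edges are tried, where `μ = min (m, k * Δ, k ^ 2)`, and at most `4 * μ + 1` moves are made
(`Searching.le`). Since `k ≤ n`, an unvisited node remains, so by connectedness the search cannot
end early (`Core.advance`). A phase of `8 * μ` rounds is therefore too long for a robot of this
cluster to stay unsettled.

Whatever crashes, unsettled robots of one cluster stay together (`Coherent`), so the number of nodes
with unsettled robots never grows from one phase start to the next. Each phase decreases it or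
contains a crash, unless it is already zero (`clusterCount_phase`); after `l + f` phases it is zero.
Settled robots are always at distinct nodes (`settled_unique`).

The memory holds a clock of polynomial range, boundedly many ports and identifiers, and flags; hence
the logarithmic bound. -/

namespace Dispersion

/-! ### Depth-first search of one cluster in a port-labelled graph. -/

section Exploration

variable {V : Type*} [Fintype V] [DecidableEq V] {G : SimpleGraph V} [DecidableRel G.Adj]
  {P : Params} {port : PortLabelling G}

/-- Port `p` of `v` and port `q` of `w` are the two ends of an edge. -/
def Link (port : PortLabelling G) (P : Params) (v : V) (p : Fin P.Δ) (w : V) (q : Fin P.Δ) : Prop :=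
  ∃ h : G.Adj v w, (port v ⟨w, h⟩ : ℕ) = p ∧ (port w ⟨v, h.symm⟩ : ℕ) = q

theorem Link.symm {v w : V} {p q : Fin P.Δ} (h : Link port P v p w q) : Link port P w q v p :=
  let ⟨a, b, c⟩ := h
  ⟨a.symm, c, b⟩

theorem Link.lt_degree {v w : V} {p q : Fin P.Δ} (h : Link port P v p w q) :
    p.val < G.degree v := by
  obtain ⟨a, b, -⟩ := h
  rw [← b]
  exact (port v ⟨w, a⟩).isLt

theorem Link.unique {v w w' : V} {p q q' : Fin P.Δ} (h : Link port P v p w q)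
    (h' : Link port P v p w' q') : w = w' ∧ q = q' := by
  obtain ⟨a, b, c⟩ := h
  obtain ⟨a', b', c'⟩ := h'
  have : (⟨w, a⟩ : G.neighborSet v) = ⟨w', a'⟩ :=
    (port v).injective (Fin.ext (b.trans b'.symm))
  obtain rfl : w = w' := congrArg Subtype.val this
  exact ⟨rfl, Fin.ext (c.symm.trans c')⟩

theorem Link.port_unique {v w : V} {p q p' q' : Fin P.Δ} (h : Link port P v p w q)
    (h' : Link port P v p' w q') : p = p' := by
  obtain ⟨a, b, c⟩ := h
  obtain ⟨a', b', c'⟩ := h'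
  exact Fin.ext (b.symm.trans b')

theorem exists_link (hΔ : P.Δ = G.maxDegree) {v : V} {p : Fin P.Δ} (hp : p.val < G.degree v) :
    ∃ w q, Link port P v p w q := by
  let e := (port v).symm ⟨p, hp⟩
  have he : G.Adj v e.1 := e.2
  refine ⟨e.1, ⟨port e.1 ⟨v, he.symm⟩, ?_⟩, he, ?_, rfl⟩
  · rw [hΔ]
    exact (port e.1 ⟨v, he.symm⟩).isLt.trans_le (G.degree_le_maxDegree _)
  · have : port v ⟨e.1, he⟩ = ⟨p, hp⟩ := (port v).apply_symm_apply _
    rw [this]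

theorem exists_link_of_adj (hΔ : P.Δ = G.maxDegree) {v w : V} (h : G.Adj v w) :
    ∃ p q, Link port P v p w q := by
  refine ⟨⟨port v ⟨w, h⟩, ?_⟩, ⟨port w ⟨v, h.symm⟩, ?_⟩, h, rfl, rfl⟩
  · rw [hΔ]
    exact (port v ⟨w, h⟩).isLt.trans_le (G.degree_le_maxDegree _)
  · rw [hΔ]
    exact (port w ⟨v, h.symm⟩).isLt.trans_le (G.degree_le_maxDegree _)

theorem nextPort_eq_some {d q : ℕ} {a : Option (Fin P.Δ)} {p : Fin P.Δ}
    (h : nextPort d a q = some p) :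
    q ≤ p.val ∧ p.val < d ∧ a ≠ some p ∧
      ∀ r : Fin P.Δ, q ≤ r.val → r.val < d → r < p → a = some r := by
  have h' := h
  unfold nextPort at h h'
  rw [List.find?_eq_some_iff_getElem] at h
  obtain ⟨h1, i, hi, h2, h3⟩ := h
  simp only [Bool.and_eq_true, decide_eq_true_eq, bne_iff_ne, ne_eq] at h1
  refine ⟨h1.1.1, h1.1.2, fun h => h1.2 h.symm, fun r hr hd hp => ?_⟩
  simp only [List.getElem_finRange] at h2
  subst h2
  have := h3 r.val hp
  simp only [List.getElem_finRange, Bool.not_eq_true', Bool.and_eq_false_iff,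
    decide_eq_false_iff_not, bne_eq_false_iff_eq] at this
  rcases this with (h | h) | h
  · exact absurd hr h
  · exact absurd hd h
  · exact h.symm

theorem nextPort_eq_none {d q : ℕ} {a : Option (Fin P.Δ)} (h : nextPort d a q = none)
    (r : Fin P.Δ) (hr : q ≤ r.val) (hd : r.val < d) : a = some r := by
  unfold nextPort at h
  rw [List.find?_eq_none] at h
  have := h r (List.mem_finRange r)
  simp only [Bool.and_eq_true, decide_eq_true_eq, bne_iff_ne, ne_eq, not_and, not_not] at this
  exact (this ⟨hr, hd⟩).symm

/-- The pointers that a settled robot keeps for the cluster which possesses its node. -/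
@[ext]
structure Ptr (P : Params) where
  parent : Option (Fin P.Δ)
  cdr : Option (Fin P.Δ)
  B : Bool

/-- The pointers after `advance`. -/
def Ptr.next (d q : ℕ) (a : Option (Fin P.Δ)) : Ptr P :=
  match nextPort d a q with
  | some p => ⟨a, some p, false⟩
  | none => ⟨a, a, true⟩

/-- The new pointers of a node and the exit port when the exploring cluster enters a node of degree
`d` through port `e`. The argument `o` holds the pointers if the cluster possesses the node. -/
def visit (d : ℕ) (e : Option (Fin P.Δ)) (o : Option (Ptr P)) : Ptr P × Option (Fin P.Δ) :=
  match o with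
  | none => (Ptr.next d 0 e, (Ptr.next d 0 e).cdr)
  | some s =>
    if e = s.parent ∨ e = s.cdr then
      if s.B then (s, s.parent)
      else
        let s' := Ptr.next d (s.cdr.elim 0 fun p => p.val + 1) s.parent
        (s', s'.cdr)
    else (s, e)

variable (port) in
/-- A path of the search tree from its first element to the root. -/
inductive IsTreePath (ptr : V → Option (Ptr P)) : V → Option (Fin P.Δ) → List V → Prop
  | root (x : V) : IsTreePath ptr x none []
  | cons (x w : V) (a p : Fin P.Δ) (s : Ptr P) (l : List V) (hs : ptr w = some s)
      (hp : s.cdr = some p) (hl : Link port P w p x a) (h : IsTreePath ptr w s.parent l) :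
      IsTreePath ptr x (some a) (w :: l)

theorem IsTreePath.congr {ptr ptr' : V → Option (Ptr P)} {x : V} {a : Option (Fin P.Δ)} {l : List V}
    (h : IsTreePath port ptr x a l) (h' : ∀ y ∈ l, ptr' y = ptr y) : IsTreePath port ptr' x a l := by
  induction h with
  | root x => exact .root x
  | cons x w a p s l hs hp hl h ih =>
    exact .cons x w a p s l ((h' w (by simp)).trans hs) hp hl
      (ih fun y hy => h' y (List.mem_cons_of_mem _ hy))

/-- The exploring cluster is done with port `p` of the node `y`, where all ports below `q` of the
current node `x` are done. -/
def Used (ptr : V → Option (Ptr P)) (x : V) (q : ℕ) (y : V) (p : Fin P.Δ) : Prop :=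
  if y = x then p.val < q
  else ∃ s, ptr y = some s ∧ (s.B = false → ∃ c, s.cdr = some c ∧ p ≤ c)

variable (port) in
/-- The state of the depth-first search when the cluster is at `x`, ready to try the ports of `x`
from `q` on: `a` is the parent port of `x`, `rest` the path from the parent of `x` to the root, `done`
the set of directed edges tried, `M` the number of moves made. -/
structure Core (ptr : V → Option (Ptr P)) (x : V) (a : Option (Fin P.Δ)) (q : ℕ) (rest : List V)
    (done : Finset (V × V)) (M : ℕ) : Prop where
  not_mem : x ∉ rest
  nodup : rest.Nodup
  mem_rest : ∀ y, y ≠ x → (y ∈ rest ↔ ∃ s, ptr y = some s ∧ s.B = false)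
  backtracked : ∀ y, y ≠ x → ∀ s, ptr y = some s → s.B = true → s.cdr = s.parent
  open_cdr : ∀ y, y ≠ x → ∀ s, ptr y = some s → s.B = false → s.cdr ≠ s.parent
  path : IsTreePath port ptr x a rest
  parent_used : ∀ y, y ≠ x → ∀ s b, ptr y = some s → s.parent = some b →
    ∃ z p, Link port P y b z p ∧ Used ptr x q z p
  -- The node `x` may still lack pointers, whence the first alternative. With connectedness, this
  -- field makes the search exhaustive.
  closed : ∀ y p z r, Used ptr x q y p → Link port P y p z r → z = x ∨ (ptr z).isSome
  done_used : ∀ y z, (y, z) ∈ done → ∃ p r, Link port P y p z r ∧ Used ptr x q y p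
  -- Every tried edge costs one move out and one back; the moves back along the `rest.length` edges
  -- of the current path are still owed.
  count : M + rest.length = 2 * done.card

variable (port) in
/-- The state of the depth-first search when the cluster is at `u`, which it entered through `e`. -/
inductive Searching (ptr : V → Option (Ptr P)) (u : V) (e : Option (Fin P.Δ)) (M : ℕ) : Prop
  | start (hptr : ∀ v, ptr v = none) (he : e = none) (hM : M = 0)
  -- The invariant is still that of the node `v` just left: port `p` counts as untried until it is
  -- known whether `u` is new, and the last move is not included in `M₀`.
  | forward (v : V) (s : Ptr P) (p r : Fin P.Δ) (rest : List V) (done : Finset (V × V)) (M₀ : ℕ)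
      (hv : ptr v = some s) (hB : s.B = false) (hcdr : s.cdr = some p) (hpar : s.cdr ≠ s.parent)
      (hlink : Link port P v p u r) (he : e = some r) (hM : M = M₀ + 1)
      (core : Core port ptr v s.parent p rest done M₀)
  | back (s : Ptr P) (p : Fin P.Δ) (rest : List V) (done : Finset (V × V))
      (hu : ptr u = some s) (hB : s.B = false) (hcdr : s.cdr = some p) (hpar : s.cdr ≠ s.parent)
      (he : e = some p) (core : Core port ptr u s.parent (p.val + 1) rest done M)

theorem Used.congr {ptr ptr' : V → Option (Ptr P)} {x y : V} {q q' : ℕ} {p : Fin P.Δ}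
    (h : Used ptr x q y p) (hq : q ≤ q') (h' : ∀ y, y ≠ x → ptr' y = ptr y) :
    Used ptr' x q' y p := by
  unfold Used at *
  split_ifs at * with hy
  · exact h.trans_le hq
  · rwa [h' y hy]

/-- The parent of `x` lies on the path, hence is open, and its current port leads to `x`.
Backtracking therefore reaches a node that the cluster enters through its `cdr`. -/
theorem Core.parent_link {ptr : V → Option (Ptr P)} {x : V} {a : Fin P.Δ} {q : ℕ} {rest : List V}
    {done : Finset (V × V)} {M : ℕ} (h : Core port ptr x (some a) q rest done M) :
    ∃ w p s l, rest = w :: l ∧ ptr w = some s ∧ s.B = false ∧ s.cdr = some p ∧ w ≠ x ∧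
      Link port P w p x a ∧ IsTreePath port ptr w s.parent l := by
  cases hp : h.path with
  | cons _ w _ p s l hs hc hl hr =>
    have hne : w ≠ x := fun e => h.not_mem (by simp [e])
    obtain ⟨s', h1, h2⟩ := (h.mem_rest w hne).1 (by simp)
    rw [hs] at h1
    cases h1
    exact ⟨w, p, s, l, rfl, hs, h2, hc, hne, hl, hr⟩

/-- No field of `Core` depends on the pointers of `x`, so these may change. Passing over the parent
port is harmless because it leads to a node already visited. -/
theorem Core.mono {ptr ptr' : V → Option (Ptr P)} {x : V} {a : Option (Fin P.Δ)} {q q' : ℕ}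
    {rest : List V} {done : Finset (V × V)} {M : ℕ} (h : Core port ptr x a q rest done M)
    (hptr : ∀ y, y ≠ x → ptr' y = ptr y) (hq : q ≤ q')
    (hskip : ∀ r : Fin P.Δ, q ≤ r.val → r.val < q' → r.val < G.degree x → a = some r) :
    Core port ptr' x a q' rest done M where
  not_mem := h.not_mem
  nodup := h.nodup
  mem_rest y hy := by rw [hptr y hy, h.mem_rest y hy]
  backtracked y hy := by rw [hptr y hy]; exact h.backtracked y hy
  open_cdr y hy := by rw [hptr y hy]; exact h.open_cdr y hy
  path := h.path.congr fun y hy => hptr y fun e => h.not_mem (e ▸ hy)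
  parent_used y hy s b hs hb := by
    rw [hptr y hy] at hs
    obtain ⟨z, p, h1, h2⟩ := h.parent_used y hy s b hs hb
    exact ⟨z, p, h1, h2.congr hq hptr⟩
  closed y p z r hu hl := by
    by_cases hz : z = x
    · exact .inl hz
    refine .inr ?_
    rw [hptr z hz]
    by_cases hy : y = x
    · subst hy
      by_cases hpq : p.val < q
      · exact (h.closed y p z r (by simp [Used, hpq]) hl).resolve_left hz
      · have hlt : p.val < q' := by simpa [Used] using hu
        obtain rfl := hskip p (not_lt.1 hpq) hlt hl.lt_degree
        obtain ⟨w, p', s, l, -, hw, -, -, -, hl', -⟩ := h.parent_link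
        obtain ⟨rfl, -⟩ := hl'.symm.unique hl
        simp [hw]
    · refine (h.closed y p z r ?_ hl).resolve_left hz
      simpa [Used, hy, hptr y hy] using hu
  done_used y z hyz := by
    obtain ⟨p, r, h1, h2⟩ := h.done_used y z hyz
    exact ⟨p, r, h1, h2.congr hq hptr⟩
  count := h.count

/-- The step of the search at a node whose next port has to be found. -/
theorem Core.advance (hΔ : P.Δ = G.maxDegree) (hG : G.Connected) {ptr ptr' : V → Option (Ptr P)}
    {x : V} {a : Option (Fin P.Δ)} {q : ℕ} {rest : List V} {done : Finset (V × V)} {M : ℕ}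
    (h : Core port ptr x a q rest done M)
    (hptr' : ptr' = Function.update ptr x (some (Ptr.next (G.degree x) q a)))
    (hfree : ∃ v, ptr' v = none) :
    ∃ p w r, (Ptr.next (G.degree x) q a).cdr = some p ∧ Link port P x p w r ∧
      Searching port ptr' w (some r) (M + 1) := by
  have hother : ∀ y, y ≠ x → ptr' y = ptr y := fun y hy => by
    rw [hptr', Function.update_of_ne hy]
  have hx : ptr' x = some (Ptr.next (G.degree x) q a) := by simp [hptr']
  cases hn : nextPort (G.degree x) a q with
  | some p =>
    have hnext : Ptr.next (G.degree x) q a = ⟨a, some p, false⟩ := by simp [Ptr.next, hn]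
    obtain ⟨h1, h2, h3, h4⟩ := nextPort_eq_some hn
    obtain ⟨w, r, hl⟩ := exists_link (port := port) hΔ h2
    refine ⟨p, w, r, by rw [hnext], hl, ?_⟩
    refine .forward x _ p r rest done M hx (by rw [hnext]) (by rw [hnext])
      (by rw [hnext]; exact h3.symm) hl rfl rfl ?_
    rw [hnext]
    exact h.mono hother h1 fun r hr hr' hd => h4 r hr hd hr'
  | none =>
    have hnext : Ptr.next (G.degree x) q a = ⟨a, a, true⟩ := by simp [Ptr.next, hn]
    have hall := nextPort_eq_none hn
    rw [hnext] at hx ⊢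
    cases a with
    | none =>
      -- At the root the path is empty, so every other visited node is exhausted, and so is `x`. The
      -- visited nodes are then closed under adjacency, which by connectedness contradicts `hfree`.
      exfalso
      have hrest : rest = [] := by
        cases h.path
        rfl
      have hvis : ∀ y z, (ptr' y).isSome → G.Adj y z → (ptr' z).isSome := by
        intro y z hy hadj
        obtain ⟨p, r, hl⟩ := exists_link_of_adj (port := port) hΔ hadj
        by_cases hz : z = x
        · simp [hz, hx]
        rw [hother z hz]
        refine (h.closed y p z r ?_ hl).resolve_left hz
        unfold Used
        split_ifs with hyx
        · by_contra hlt
          subst hyx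
          cases hall p (not_lt.1 hlt) hl.lt_degree
        · rw [hother y hyx] at hy
          obtain ⟨s, hs⟩ := Option.isSome_iff_exists.1 hy
          refine ⟨s, hs, fun hB => ?_⟩
          have := (h.mem_rest y hyx).2 ⟨s, hs, hB⟩
          simp [hrest] at this
      obtain ⟨v, hv⟩ := hfree
      have hwalk : ∀ v, G.Walk x v → (ptr' v).isSome := by
        have : ∀ u v, G.Walk u v → (ptr' u).isSome → (ptr' v).isSome := by
          intro u v W
          induction W with
          | nil => exact id
          | cons hadj _ ih => exact fun hu => ih (hvis _ _ hu hadj)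
        exact fun v W => this x v W (by simp [hx])
      have := hwalk v (hG.preconnected x v).some
      simp [hv] at this
    | some a =>
      obtain ⟨w, p, s, l, hrest, hw, hB, hc, hne, hl, hpath⟩ := h.parent_link
      have hw' : ptr' w = some s := (hother w hne).trans hw
      have hopen := h.open_cdr w hne s hw hB
      have hnd := h.nodup
      rw [hrest, List.nodup_cons] at hnd
      -- The flag of `x` is now set, so all its ports count as used. At `w`, which becomes the
      -- current node, the ports up to its `cdr` are used, whence the bound `p.val + 1`.
      have hused : ∀ y r, Used ptr x q y r → Used ptr' w (p.val + 1) y r := by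
        intro y r hu
        unfold Used at hu ⊢
        split_ifs at hu with hyx
        · subst hyx
          rw [if_neg hne.symm]
          exact ⟨_, hx, by simp⟩
        · split_ifs with hyw
          · subst hyw
            obtain ⟨s', h1, h2⟩ := hu
            rw [hw] at h1
            cases h1
            obtain ⟨c, h3, h4⟩ := h2 hB
            rw [hc] at h3
            cases h3
            exact Nat.lt_succ_of_le h4
          · rwa [hother y hyx]
      refine ⟨a, w, p, rfl, hl.symm, .back s p l done hw' hB hc hopen rfl ?_⟩
      constructor
      · exact hnd.1
      · exact hnd.2
      · intro y hy
        by_cases hyx : y = x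
        · subst hyx
          have : y ∉ l := fun hm => h.not_mem (by simp [hrest, hm])
          simp [hx, this]
        · rw [hother y hyx, ← h.mem_rest y hyx, hrest]
          simp [hy]
      · intro y hy t ht
        by_cases hyx : y = x
        · subst hyx
          rw [hx] at ht
          cases ht
          simp
        · rw [hother y hyx] at ht
          exact h.backtracked y hyx t ht
      · intro y hy t ht
        by_cases hyx : y = x
        · subst hyx
          rw [hx] at ht
          cases ht
          simp
        · rw [hother y hyx] at ht
          exact h.open_cdr y hyx t ht
      · refine hpath.congr fun y hy => hother y ?_
        rintro rfl
        exact h.not_mem (by simp [hrest, hy])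
      · intro y hy t b ht hb
        by_cases hyx : y = x
        · subst hyx
          rw [hx] at ht
          cases ht
          cases hb
          refine ⟨w, p, hl.symm, by simp [Used]⟩
        · rw [hother y hyx] at ht
          obtain ⟨z, r, h1, h2⟩ := h.parent_used y hyx t b ht hb
          exact ⟨z, r, h1, hused _ _ h2⟩
      · intro y r z r' hu hlk
        by_cases hzw : z = w
        · exact .inl hzw
        refine .inr ?_
        by_cases hzx : z = x
        · simp [hzx, hx]
        rw [hother z hzx]
        by_cases hyx : y = x
        · subst hyx
          by_cases hq : r.val < q
          · exact (h.closed y r z r' (by simp [Used, hq]) hlk).resolve_left hzx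
          · obtain hra := hall r (not_lt.1 hq) hlk.lt_degree
            cases hra
            exact absurd (hl.symm.unique hlk).1.symm hzw
        · refine (h.closed y r z r' ?_ hlk).resolve_left hzx
          unfold Used at hu ⊢
          rw [if_neg hyx]
          split_ifs at hu with hyw
          · subst hyw
            exact ⟨s, hw, fun _ => ⟨p, hc, Nat.le_of_lt_succ hu⟩⟩
          · rwa [hother y hyx] at hu
      · intro y z hyz
        obtain ⟨b, r, h1, h2⟩ := h.done_used y z hyz
        exact ⟨b, r, h1, hused _ _ h2⟩
      · have := h.count
        rw [hrest, List.length_cons] at this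
        omega

/-- Done edges leave `v` through ports below `p`, and in a simple graph the edge to `u` has only one
port at `v`. -/
theorem Core.not_mem_done {ptr : V → Option (Ptr P)} {v u : V} {a : Option (Fin P.Δ)}
    {p r : Fin P.Δ} {rest : List V} {done : Finset (V × V)} {M : ℕ}
    (h : Core port ptr v a p rest done M) (hl : Link port P v p u r) : (v, u) ∉ done := by
  intro hm
  obtain ⟨p', r', h1, h2⟩ := h.done_used v u hm
  obtain rfl := hl.port_unique h1
  simp [Used] at h2

/-- The cluster enters a new node. -/
theorem Core.push {ptr : V → Option (Ptr P)} {v u : V} {s : Ptr P}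
    {p r : Fin P.Δ} {rest : List V} {done : Finset (V × V)} {M : ℕ}
    (h : Core port ptr v s.parent p rest done M) (hv : ptr v = some s) (hB : s.B = false)
    (hcdr : s.cdr = some p) (hpar : s.cdr ≠ s.parent) (hl : Link port P v p u r)
    (hu : ptr u = none) :
    Core port ptr u (some r) 0 (v :: rest) (insert (v, u) done) (M + 1) := by
  have hne : v ≠ u := fun e => by simp [← e, hv] at hu
  have hused : ∀ y b, Used ptr v p y b → Used ptr u 0 y b := by
    intro y b hb
    unfold Used at hb ⊢
    split_ifs at hb with hyv
    · subst hyv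
      rw [if_neg hne]
      exact ⟨s, hv, fun _ => ⟨p, hcdr, le_of_lt hb⟩⟩
    · split_ifs with hyu
      · subst hyu
        obtain ⟨t, ht, -⟩ := hb
        simp [hu] at ht
      · exact hb
  have hvu : Used ptr u 0 v p := by
    rw [Used, if_neg hne]
    exact ⟨s, hv, fun _ => ⟨p, hcdr, le_rfl⟩⟩
  have hnot : u ∉ rest := fun hm => by
    obtain ⟨t, ht, -⟩ := (h.mem_rest u hne.symm).1 hm
    simp [hu] at ht
  constructor
  · simp [hne.symm, hnot]
  · exact List.nodup_cons.2 ⟨h.not_mem, h.nodup⟩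
  · intro y hy
    by_cases hyv : y = v
    · subst hyv
      simp [hv, hB]
    · simp [hyv, h.mem_rest y hyv]
  · intro y hy t ht hBt
    by_cases hyv : y = v
    · subst hyv
      rw [hv] at ht
      cases ht
      simp [hB] at hBt
    · exact h.backtracked y hyv t ht hBt
  · intro y hy t ht hBt
    by_cases hyv : y = v
    · subst hyv
      rw [hv] at ht
      cases ht
      exact hpar
    · exact h.open_cdr y hyv t ht hBt
  · exact .cons u v r p s rest hv hcdr hl h.path
  · intro y hy t b ht hb
    by_cases hyv : y = v
    · subst hyv
      rw [hv] at ht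
      cases ht
      have h' := h
      rw [hb] at h'
      obtain ⟨w, c, s', l, -, hw, hB', hc, hne', hl', -⟩ := h'.parent_link
      refine ⟨w, c, hl'.symm, hused _ _ ?_⟩
      rw [Used, if_neg hne']
      exact ⟨s', hw, fun _ => ⟨c, hc, le_rfl⟩⟩
    · obtain ⟨z, c, h1, h2⟩ := h.parent_used y hyv t b ht hb
      exact ⟨z, c, h1, hused _ _ h2⟩
  · intro y b z c hub hlk
    by_cases hzu : z = u
    · exact .inl hzu
    refine .inr ?_
    by_cases hzv : z = v
    · simp [hzv, hv]
    refine (h.closed y b z c ?_ hlk).resolve_left hzv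
    unfold Used at hub ⊢
    split_ifs at hub with hyu
    · omega
    · split_ifs with hyv
      · subst hyv
        obtain ⟨t, ht, h2⟩ := hub
        rw [hv] at ht
        cases ht
        obtain ⟨c', h3, h4⟩ := h2 hB
        rw [hcdr] at h3
        cases h3
        -- The only port of `v` that becomes used is `p`, and it leads to `u`, which is excluded
        -- here.
        refine lt_of_le_of_ne h4 fun e => hzu ?_
        obtain rfl := Fin.ext e
        exact (hlk.unique hl).1
      · exact hub
  · intro y z hyz
    rcases Finset.mem_insert.1 hyz with e | hyz
    · cases e
      exact ⟨p, r, hl, hvu⟩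
    · obtain ⟨b, c, h1, h2⟩ := h.done_used y z hyz
      exact ⟨b, c, h1, hused _ _ h2⟩
  · rw [Finset.card_insert_of_notMem (h.not_mem_done hl), List.length_cons]
    have := h.count
    omega

/-- The cluster returns from a node that it visited before. -/
theorem Core.bounce {ptr : V → Option (Ptr P)} {v u : V} {a : Option (Fin P.Δ)}
    {p r : Fin P.Δ} {rest : List V} {done : Finset (V × V)} {M : ℕ}
    (h : Core port ptr v a p rest done M) (hl : Link port P v p u r) (hu : (ptr u).isSome) :
    Core port ptr v a (p.val + 1) rest (insert (v, u) done) (M + 2) := by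
  have hused : ∀ y b, Used ptr v p y b → Used ptr v (p.val + 1) y b := fun y b hb =>
    hb.congr (Nat.le_succ _) fun _ _ => rfl
  refine ⟨h.not_mem, h.nodup, h.mem_rest, h.backtracked, h.open_cdr, h.path, ?_, ?_, ?_, ?_⟩
  · intro y hy t b ht hb
    obtain ⟨z, c, h1, h2⟩ := h.parent_used y hy t b ht hb
    exact ⟨z, c, h1, hused _ _ h2⟩
  · intro y b z c hub hlk
    by_cases hyp : y = v ∧ b = p
    · obtain ⟨rfl, rfl⟩ := hyp
      obtain ⟨rfl, -⟩ := hl.unique hlk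
      exact .inr hu
    · refine h.closed y b z c ?_ hlk
      unfold Used at hub ⊢
      split_ifs at hub ⊢ with hyv
      · refine lt_of_le_of_ne (Nat.le_of_lt_succ hub) fun e => hyp ⟨hyv, Fin.ext e⟩
      · exact hub
  · intro y z hyz
    rcases Finset.mem_insert.1 hyz with e | hyz
    · cases e
      exact ⟨p, r, hl, by simp [Used]⟩
    · obtain ⟨b, c, h1, h2⟩ := h.done_used y z hyz
      exact ⟨b, c, h1, hused _ _ h2⟩
  · rw [Finset.card_insert_of_notMem (h.not_mem_done hl)]
    have := h.count
    omega

/-- The current port of each path node leads to the next node towards `x`, and the other end of that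
edge is the parent port there. -/
theorem IsTreePath.exists_child {ptr : V → Option (Ptr P)} {x : V} {a : Option (Fin P.Δ)}
    {l : List V} (h : IsTreePath port ptr x a l) {u : V} (hu : u ∈ l) :
    ∃ s p z b, ptr u = some s ∧ s.cdr = some p ∧ Link port P u p z b ∧
      ((z = x ∧ a = some b) ∨ (∃ t, z ∈ l ∧ ptr z = some t ∧ t.parent = some b)) := by
  induction h with
  | root => simp at hu
  | cons x w a p s l hs hp hl h ih =>
    rcases List.mem_cons.1 hu with rfl | hu
    · exact ⟨s, p, x, a, hs, hp, hl, .inl ⟨rfl, rfl⟩⟩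
    · obtain ⟨s', p', z, b, h1, h2, h3, h4⟩ := ih hu
      refine ⟨s', p', z, b, h1, h2, h3, .inr ?_⟩
      rcases h4 with ⟨rfl, h5⟩ | ⟨t, h5, h6, h7⟩
      · exact ⟨s, by simp, hs, h5⟩
      · exact ⟨t, by simp [h5], h6, h7⟩

/-- An edge that leads to a node visited before is not an edge of the search tree. -/
theorem Core.not_tree_edge {ptr : V → Option (Ptr P)} {v u : V} {s t : Ptr P}
    {p r : Fin P.Δ} {rest : List V} {done : Finset (V × V)} {M : ℕ}
    (h : Core port ptr v s.parent p rest done M)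
    (hcdr : s.cdr = some p) (hpar : s.cdr ≠ s.parent)
    (hl : Link port P v p u r) (hu : ptr u = some t) : ¬ (some r = t.parent ∨ some r = t.cdr) := by
  have hne : u ≠ v := fun e => by
    obtain ⟨ha, -⟩ := hl
    exact ha.ne e.symm
  -- The parent edge of a visited node is used from the parent's side, whereas `p` is still unused
  -- at `v`.
  have hparent : some r ≠ t.parent := by
    intro e
    obtain ⟨z, c, h1, h2⟩ := h.parent_used u hne t r hu e.symm
    obtain ⟨rfl, rfl⟩ := hl.symm.unique h1
    simp [Used] at h2
  rintro (e | e)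
  · exact hparent e
  · cases hB : t.B with
    | true => exact hparent (e.trans (h.backtracked u hne t hu hB))
    | false =>
      -- Now `u` is on the path and its current port leads one node further towards `v`. If that
      -- node were `v`, then `p` would be the parent port of `v`; if it were on the path above `v`,
      -- then `v` would occur there.
      obtain ⟨t', c, z, b, h1, h2, h3, h4⟩ :=
        h.path.exists_child ((h.mem_rest u hne).2 ⟨t, hu, hB⟩)
      rw [hu] at h1
      cases h1
      rw [h2] at e
      cases e
      obtain ⟨rfl, rfl⟩ := hl.symm.unique h3
      rcases h4 with ⟨-, h5⟩ | ⟨t', h5, -, -⟩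
      · exact hpar (hcdr.trans h5.symm)
      · exact h.not_mem h5

theorem core_start {ptr : V → Option (Ptr P)} (hptr : ∀ v, ptr v = none) (u : V) :
    Core port ptr u none 0 [] ∅ 0 := by
  have hU : ∀ y p, ¬ Used ptr u 0 y p := by
    intro y p hu
    unfold Used at hu
    split_ifs at hu
    · omega
    · obtain ⟨s, hs, -⟩ := hu
      simp [hptr] at hs
  constructor <;> simp_all [IsTreePath.root]

/-- One round of the exploring cluster. -/
theorem Searching.step (hΔ : P.Δ = G.maxDegree) (hG : G.Connected) {ptr ptr' : V → Option (Ptr P)}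
    {u : V} {e : Option (Fin P.Δ)} {M : ℕ} (h : Searching port ptr u e M)
    (hptr' : ptr' = Function.update ptr u (some (visit (G.degree u) e (ptr u)).1))
    (hfree : ∃ v, ptr' v = none) :
    ∃ p w r, (visit (G.degree u) e (ptr u)).2 = some p ∧ Link port P u p w r ∧
      Searching port ptr' w (some r) (M + 1) := by
  cases h with
  | start hptr he hM =>
    subst he hM
    rw [hptr u] at hptr' ⊢
    exact (core_start hptr u).advance hΔ hG hptr' hfree
  | forward v s p r rest done M₀ hv hB hcdr hpar hlink he hM core =>
    subst he hM
    cases hu : ptr u with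
    | none =>
      rw [hu] at hptr'
      exact (core.push hv hB hcdr hpar hlink hu).advance hΔ hG hptr' hfree
    | some t =>
      rw [hu] at hptr'
      have hnot := core.not_tree_edge hcdr hpar hlink hu
      have hvisit : visit (G.degree u) (some r) (some t) = (t, some r) := by
        simp only [visit, if_neg hnot]
      rw [hvisit] at hptr' ⊢
      have hsame : ptr' = ptr := by rw [hptr', ← hu, Function.update_eq_self]
      rw [hsame]
      exact ⟨r, v, p, rfl, hlink.symm, .back s p rest _ hv hB hcdr hpar rfl
        (core.bounce hlink (by simp [hu]))⟩
  | back s p rest done hu hB hcdr hpar he core =>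
    subst he
    rw [hu] at hptr' ⊢
    have hvisit : visit (G.degree u) (some p) (some s) =
        (Ptr.next (G.degree u) (p.val + 1) s.parent,
          (Ptr.next (G.degree u) (p.val + 1) s.parent).cdr) := by
      simp [visit, hB, hcdr]
    rw [hvisit] at hptr' ⊢
    exact core.advance hΔ hG hptr' hfree

/-- The set `done` consists of directed edges between visited nodes. It is bounded in three ways: by
all darts of the graph, by the pairs in `S`, and by the darts leaving `S`. Only the first count
needs the factor 2. -/
theorem Core.card_done_le (hΔ : P.Δ = G.maxDegree) {ptr : V → Option (Ptr P)} {x : V}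
    {a : Option (Fin P.Δ)} {q : ℕ} {rest : List V} {done : Finset (V × V)} {M : ℕ}
    (h : Core port ptr x a q rest done M) (hx : (ptr x).isSome) {n : ℕ} {S : Finset V}
    (hS : ∀ v, (ptr v).isSome → v ∈ S) (hn : S.card ≤ n) :
    done.card ≤ 2 * min G.edgeFinset.card (min (n * P.Δ) (n ^ 2)) := by
  have hdone : ∀ y z, (y, z) ∈ done → G.Adj y z ∧ y ∈ S ∧ z ∈ S := by
    intro y z hyz
    obtain ⟨p, r, h1, h2⟩ := h.done_used y z hyz
    refine ⟨h1.1, hS y ?_, hS z ?_⟩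
    · unfold Used at h2
      split_ifs at h2 with hy
      · rwa [hy]
      · obtain ⟨s, hs, -⟩ := h2
        simp [hs]
    · rcases h.closed y p z r h2 h1 with rfl | hz
      · exact hx
      · exact hz
  have hm : done.card ≤ 2 * G.edgeFinset.card := by
    rw [← G.dart_card_eq_twice_card_edges, ← Finset.card_univ]
    refine (Finset.card_le_card (t := Finset.univ.image (fun d : G.Dart => d.toProd)) ?_).trans
      Finset.card_image_le
    rintro ⟨y, z⟩ hyz
    exact Finset.mem_image.2 ⟨⟨(y, z), (hdone y z hyz).1⟩, Finset.mem_univ _, rfl⟩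
  have hk : done.card ≤ n ^ 2 := by
    calc done.card ≤ (S ×ˢ S).card := Finset.card_le_card fun ⟨y, z⟩ hyz =>
          Finset.mem_product.2 (hdone y z hyz).2
      _ = S.card * S.card := Finset.card_product _ _
      _ ≤ n ^ 2 := by rw [sq]; exact Nat.mul_le_mul hn hn
  have hkΔ : done.card ≤ n * P.Δ := by
    calc done.card ≤ (S.sigma fun v => G.neighborFinset v).card := by
          refine Finset.card_le_card_of_injOn (fun e => ⟨e.1, e.2⟩) ?_ ?_
          · rintro ⟨y, z⟩ hyz
            have := hdone y z hyz
            simp [this.1, this.2.1]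
          · rintro ⟨y, z⟩ - ⟨y', z'⟩ - he
            simpa using he
      _ = ∑ v ∈ S, G.degree v := by simp
      _ ≤ S.card * P.Δ := by
          rw [hΔ]
          exact Finset.sum_le_card_nsmul _ _ _ fun v _ => G.degree_le_maxDegree v
      _ ≤ n * P.Δ := Nat.mul_le_mul_right _ hn
  omega

/-- The number of moves is bounded in terms of the number of nodes visited. -/
theorem Searching.le (hΔ : P.Δ = G.maxDegree) {ptr : V → Option (Ptr P)}
    {u : V} {e : Option (Fin P.Δ)} {M : ℕ} (h : Searching port ptr u e M) {n : ℕ} {S : Finset V}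
    (hS : ∀ v, (ptr v).isSome → v ∈ S) (hn : S.card ≤ n) :
    M ≤ 4 * min G.edgeFinset.card (min (n * P.Δ) (n ^ 2)) + 1 := by
  cases h with
  | start hptr he hM => omega
  | forward v s p r rest done M₀ hv hB hcdr hpar hlink he hM core =>
    have := core.card_done_le hΔ (by simp [hv]) hS hn
    have := core.count
    omega
  | back s p rest done hu hB hcdr hpar he core =>
    have := core.card_done_le hΔ (by simp [hu]) hS hn
    have := core.count
    omega

end Exploration

/-! ### The decisions of the robots at one node. -/

section Decisions

variable {P : Params}

/-- The pointers in a memory. -/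
def Mem.ptr (s : Mem P) : Ptr P := ⟨s.parent, s.cdr, s.B⟩

theorem advance_fields (d q : ℕ) (s : Mem P) :
    (advance d q s).clock = s.clock ∧ (advance d q s).settled = s.settled ∧
      (advance d q s).cid = s.cid ∧ (advance d q s).ptr = Ptr.next d q s.parent := by
  unfold advance Ptr.next
  split <;> simp_all [Mem.ptr]

theorem explorer_eq_some {w : Fin P.k → Option (Mem P)} {j : Fin P.k} {s : Mem P}
    (h : explorer w = some (j, s)) :
    w j = some s ∧ s.settled = false ∧ s.waiting = false ∧ s.cid = topPriority w := by
  unfold explorer at h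
  obtain ⟨i, -, hi⟩ := List.exists_of_findSome?_eq_some h
  split at hi
  · split_ifs at hi with hc
    cases hi
    simp_all
  · cases hi

theorem explorer_ne_none {w : Fin P.k → Option (Mem P)} {j : Fin P.k} {s : Mem P}
    (hj : w j = some s) (hs : s.settled = false) (hw : s.waiting = false)
    (hc : s.cid = topPriority w) : explorer w ≠ none := by
  intro h
  unfold explorer at h
  rw [List.findSome?_eq_none_iff] at h
  have := h j (List.mem_finRange j)
  simp [hj, hs, hw, hc] at this

theorem settler_eq_some {w : Fin P.k → Option (Mem P)} {j : Fin P.k} {s : Mem P}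
    (h : settler w = some (j, s)) : w j = some s ∧ s.settled = true := by
  unfold settler at h
  obtain ⟨i, -, hi⟩ := List.exists_of_findSome?_eq_some h
  split at hi
  · split_ifs at hi with hc
    cases hi
    simp_all
  · cases hi

theorem settled_of_settler_eq_none {w : Fin P.k → Option (Mem P)} (h : settler w = none)
    {j : Fin P.k} {s : Mem P} (hj : w j = some s) : s.settled = false := by
  unfold settler at h
  rw [List.findSome?_eq_none_iff] at h
  have := h j (List.mem_finRange j)
  simpa [hj] using this

theorem le_topPriority {w : Fin P.k → Option (Mem P)} {j : Fin P.k} {s : Mem P}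
    (hj : w j = some s) (hs : s.settled = false) : s.cid ≤ topPriority w := by
  refine le_trans ?_ (Finset.le_sup (Finset.mem_univ j))
  simp [hj, hs]

theorem topPriority_le {w : Fin P.k → Option (Mem P)} {c : WithBot (Fin P.k)}
    (h : ∀ j s, w j = some s → s.settled = false → s.cid ≤ c) : topPriority w ≤ c := by
  refine Finset.sup_le fun j _ => ?_
  cases hj : w j with
  | none => simp
  | some s =>
    by_cases hs : s.settled
    · simp [hs]
    · simpa [hs] using h j s hj (by simpa using hs)

/-- This is the bridge from the algorithm to `visit`. A settled robot of a weaker cluster enters as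
`none`, exactly like an empty node, so possession by weaker clusters leaves no trace in the search.
-/
theorem plan_spec {d : ℕ} {w : Fin P.k → Option (Mem P)} {π : Plan P} (h : plan d w = some π) :
    ∃ r x, explorer w = some (r, x) ∧ π.mem.settled = true ∧ π.mem.cid = x.cid ∧
      (∃ s, w π.owner = some s ∧ π.mem.clock = s.clock) ∧
      ((settler w = none ∧ π.owner = r) ∨
        ∃ s, settler w = some (π.owner, s) ∧ s.cid ≤ x.cid) ∧
      (π.mem.ptr, π.exit) = visit d x.entry
        (match settler w with
          | none => none
          | some (_, s) => if s.cid = x.cid then some s.ptr else none) := by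
  unfold plan at h
  split at h
  · cases h
  · rename_i r x hx
    refine ⟨r, x, hx, ?_⟩
    split at h
    · rename_i hs
      cases h
      obtain ⟨h1, h2, h3, h4⟩ := advance_fields d 0
        { x with settled := true, cid := x.cid, parent := x.entry, entry := none, waiting := false }
      refine ⟨h2, h3, ⟨x, (explorer_eq_some hx).1, h1⟩, .inl ⟨hs, rfl⟩, ?_⟩
      simp only [visit, claim]
      exact Prod.ext h4 (congrArg Ptr.cdr h4)
    · rename_i o s hs
      obtain ⟨hwo, hset⟩ := settler_eq_some hs
      split_ifs at h with h1 h2 h3 h4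
      · cases h
        obtain ⟨k1, k2, k3, k4⟩ := advance_fields d 0
          { s with settled := true, cid := x.cid, parent := x.entry, entry := none, waiting := false }
        refine ⟨k2, k3, ⟨s, hwo, k1⟩, .inr ⟨s, hs, h2.le⟩, ?_⟩
        simp only [visit, claim, if_neg h2.ne]
        exact Prod.ext k4 (congrArg Ptr.cdr k4)
      all_goals
        have hc : s.cid = x.cid := le_antisymm (not_lt.1 h1) (not_lt.1 h2)
        cases h
      · refine ⟨hset, hc, ⟨s, hwo, rfl⟩, .inr ⟨s, hs, hc.le⟩, ?_⟩
        simp only [visit, if_pos hc, Mem.ptr, if_pos h3, h4, if_true]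
      · obtain ⟨k1, k2, k3, k4⟩ := advance_fields d (s.cdr.elim 0 fun p => p.val + 1) s
        refine ⟨k2.trans hset, k3.trans hc, ⟨s, hwo, k1⟩, .inr ⟨s, hs, hc.le⟩, ?_⟩
        simp only [visit, if_pos hc]
        have h3' : x.entry = s.ptr.parent ∨ x.entry = s.ptr.cdr := h3
        have h4' : ¬ s.ptr.B = true := h4
        simp only [if_pos h3', if_neg h4']
        exact Prod.ext k4 (congrArg Ptr.cdr k4)
      · refine ⟨hset, hc, ⟨s, hwo, rfl⟩, .inr ⟨s, hs, hc.le⟩, ?_⟩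
        simp only [visit, if_pos hc]
        have h3' : ¬ (x.entry = s.ptr.parent ∨ x.entry = s.ptr.cdr) := h3
        simp only [if_neg h3']

theorem plan_ne_none {d : ℕ} {w : Fin P.k → Option (Mem P)} {r : Fin P.k} {x : Mem P}
    (hx : explorer w = some (r, x)) (hs : ∀ j s, w j = some s → s.settled = true → s.cid ≤ x.cid) :
    ∃ π, plan d w = some π := by
  unfold plan
  simp only [hx]
  split
  · exact ⟨_, rfl⟩
  · rename_i o s ho
    obtain ⟨h1, h2⟩ := settler_eq_some ho
    rw [if_neg (not_lt.2 (hs o s h1 h2))]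
    split_ifs <;> exact ⟨_, rfl⟩

theorem execute_of_owner {π : Plan P} {c : WithBot (Fin P.k)} {i : Fin P.k} {s : Mem P}
    (h : i = π.owner) : execute (some π) c i s = (π.mem, none) := by
  simp [execute, h]

theorem execute_of_settled {π : Option (Plan P)} {c : WithBot (Fin P.k)} {i : Fin P.k} {s : Mem P}
    (h : ∀ π', π = some π' → i ≠ π'.owner) (hs : s.settled = true) :
    execute π c i s = (s, none) := by
  cases π with
  | none => simp [execute, hs]
  | some π => simp [execute, h π rfl, hs]

/-- A robot that does not own the plan can change only its `waiting` flag in `execute`. -/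
theorem execute_of_unsettled {π : Option (Plan P)} {c : WithBot (Fin P.k)} {i : Fin P.k} {s : Mem P}
    (h : ∀ π', π = some π' → i ≠ π'.owner) :
    (execute π c i s).1.settled = s.settled ∧ (execute π c i s).1.cid = s.cid ∧
      (execute π c i s).1.clock = s.clock ∧ (execute π c i s).1.entry = s.entry := by
  unfold execute
  cases π with
  | none =>
    dsimp only
    split_ifs <;> simp
  | some π =>
    simp only [if_neg (h π rfl)]
    cases π.exit <;> dsimp only <;> split_ifs <;> simp

/-- Robots that agree in the relevant fields do the same. -/
theorem execute_congr {π : Option (Plan P)} {c : WithBot (Fin P.k)} {i j : Fin P.k} {s t : Mem P}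
    (hi : ∀ π', π = some π' → i ≠ π'.owner) (hj : ∀ π', π = some π' → j ≠ π'.owner)
    (hs : s.settled = t.settled) (hc : s.cid = t.cid) (hw : s.waiting = t.waiting) :
    (execute π c i s).1.waiting = (execute π c j t).1.waiting ∧
      (execute π c i s).2 = (execute π c j t).2 := by
  unfold execute
  cases π with
  | none =>
    simp only [hs]
    split_ifs <;> simp [hw]
  | some π =>
    simp only [if_neg (hi π rfl), if_neg (hj π rfl), hs, hc, hw]
    cases π.exit <;> dsimp only <;> split_ifs <;> simp_all

theorem execute_exit {π : Plan P} {c : WithBot (Fin P.k)} {i : Fin P.k} {s : Mem P} {p : Fin P.Δ}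
    (h : i ≠ π.owner) (hs : s.settled = false) (hw : s.waiting = false) (hp : π.exit = some p)
    (hc : s.cid = c) : execute (some π) c i s = (s, some p.val) := by
  simp [execute, h, hs, hw, hp, hc]

/-- The refreshed memory of a robot. -/
def refreshed (clock : ℕ) (w : Fin P.k → Option (Mem P)) (s : Mem P) : Mem P :=
  if clock % P.phaseLength = 0 then s.reset (maxUnsettledId w) else s

theorem refresh_apply (clock : ℕ) (w : Fin P.k → Option (Mem P)) (i : Fin P.k) :
    refresh clock w i = (w i).map (refreshed clock w) := by
  unfold refresh refreshed
  split_ifs <;> simp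

theorem refreshed_clock (clock : ℕ) (w : Fin P.k → Option (Mem P)) (s : Mem P) :
    (refreshed clock w s).clock = s.clock := by
  unfold refreshed
  split_ifs <;> rfl

theorem refreshed_settled (clock : ℕ) (w : Fin P.k → Option (Mem P)) (s : Mem P) :
    (refreshed clock w s).settled = s.settled := by
  unfold refreshed
  split_ifs <;> rfl

/-- The supremum is attained, so the identifier of a cluster names a robot at its node. Hence
clusters formed at different nodes have different identifiers. -/
theorem exists_maxUnsettledId {w : Fin P.k → Option (Mem P)} {j : Fin P.k} {s : Mem P}
    (hj : w j = some s) (hs : s.settled = false) :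
    ∃ i : Fin P.k, maxUnsettledId w = i ∧ ∃ s, w i = some s ∧ s.settled = false := by
  obtain ⟨i, -, hi⟩ := Finset.exists_mem_eq_sup Finset.univ ⟨j, Finset.mem_univ j⟩
    (fun j => if (w j).any (fun s => !s.settled) then (j : WithBot (Fin P.k)) else ⊥)
  have hle := Finset.le_sup (f := fun j => if (w j).any (fun s => !s.settled)
    then (j : WithBot (Fin P.k)) else ⊥) (Finset.mem_univ j)
  rw [hi] at hle
  have hij : (w i).any (fun s => !s.settled) = true := by
    by_contra hc
    simp [hj, hs, hc] at hle
  refine ⟨i, ?_, ?_⟩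
  · unfold maxUnsettledId
    rw [hi]
    simp [hij]
  · simpa [Option.any_eq_true] using hij

theorem le_maxUnsettledId {w : Fin P.k → Option (Mem P)} {j : Fin P.k} {s : Mem P}
    (hj : w j = some s) (hs : s.settled = false) : (j : WithBot (Fin P.k)) ≤ maxUnsettledId w := by
  refine le_trans ?_ (Finset.le_sup (Finset.mem_univ j))
  simp [hj, hs]

end Decisions

/-! ### Single rounds of the execution and the behaviour of settled robots. -/

section Rounds

variable {V : Type*} [Fintype V] [DecidableEq V] {G : SimpleGraph V} [DecidableRel G.Adj]
  {P : Params} (port : PortLabelling G) (crash : Fin P.k → ℕ∞) (start : Fin P.k → V)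

/-- The position of robot `i` after `t` rounds. -/
noncomputable def posAt (t : ℕ) (i : Fin P.k) : V :=
  (run (clusterDFS P) port crash start t).pos i

/-- The memory of robot `i` after `t` rounds. -/
noncomputable def memAt (t : ℕ) (i : Fin P.k) : Mem P :=
  (run (clusterDFS P) port crash start t).mem i

/-- What the robots at `v` read in round `t`. -/
noncomputable def viewAt (t : ℕ) (v : V) : Fin P.k → Option (Mem P) :=
  view (clusterDFS P) crash t (run (clusterDFS P) port crash start t) v

/-- The memory of robot `i` in round `t`, after the reset if a phase starts. -/
noncomputable def memIn (t : ℕ) (i : Fin P.k) : Mem P :=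
  refreshed t (viewAt port crash start t (posAt port crash start t i)) (memAt port crash start t i)

/-- The refreshed memories of the robots at `v` in round `t`. -/
noncomputable def viewIn (t : ℕ) (v : V) : Fin P.k → Option (Mem P) :=
  refresh t (viewAt port crash start t v)

/-- The plan for the node `v` in round `t`. -/
noncomputable def planAt (t : ℕ) (v : V) : Option (Plan P) :=
  plan (G.degree v) (viewIn port crash start t v)

/-- The memory and the exit port that robot `i` computes in round `t`. -/
noncomputable def outcome (t : ℕ) (i : Fin P.k) : Mem P × Option ℕ :=
  execute (planAt port crash start t (posAt port crash start t i))
    (topPriority (viewIn port crash start t (posAt port crash start t i))) i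
    (memIn port crash start t i)

variable {port crash start}

theorem Alive.of_succ {t : ℕ} {i : Fin P.k} (h : Alive crash (t + 1) i) : Alive crash t i := by
  unfold Alive at *
  exact lt_of_le_of_lt (by exact_mod_cast Nat.le_succ t) h

theorem Alive.mono {t t' : ℕ} {i : Fin P.k} (h : Alive crash t' i) (ht : t ≤ t') :
    Alive crash t i := by
  unfold Alive at *
  exact lt_of_le_of_lt (by exact_mod_cast ht) h

theorem viewAt_eq_some {t : ℕ} {v : V} {j : Fin P.k} {s : Mem P} :
    viewAt port crash start t v j = some s ↔
      Alive crash t j ∧ posAt port crash start t j = v ∧ memAt port crash start t j = s := by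
  by_cases h : Alive crash t j ∧ posAt port crash start t j = v
  · have hv : viewAt port crash start t v j = some (memAt port crash start t j) := if_pos h
    rw [hv, Option.some_inj]
    exact ⟨fun e => ⟨h.1, h.2, e⟩, fun e => e.2.2⟩
  · have hv : viewAt port crash start t v j = none := if_neg h
    rw [hv]
    exact ⟨fun e => absurd e (by simp), fun e => absurd ⟨e.1, e.2.1⟩ h⟩

theorem viewIn_eq_some {t : ℕ} {v : V} {j : Fin P.k} {s : Mem P} :
    viewIn port crash start t v j = some s ↔
      Alive crash t j ∧ posAt port crash start t j = v ∧ memIn port crash start t j = s := by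
  unfold viewIn
  rw [refresh_apply, Option.map_eq_some_iff]
  constructor
  · rintro ⟨s', h1, rfl⟩
    obtain ⟨h2, rfl, rfl⟩ := viewAt_eq_some.1 h1
    exact ⟨h2, rfl, rfl⟩
  · rintro ⟨h1, rfl, rfl⟩
    exact ⟨_, viewAt_eq_some.2 ⟨h1, rfl, rfl⟩, rfl⟩

theorem memIn_settled (t : ℕ) (i : Fin P.k) :
    (memIn port crash start t i).settled = (memAt port crash start t i).settled :=
  refreshed_settled _ _ _

theorem step_eq {t : ℕ} (ht : t < P.totalRounds) {i : Fin P.k} (ha : Alive crash t i)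
    (hclock : (memAt port crash start t i).clock.val = t) :
    (posAt port crash start (t + 1) i, memAt port crash start (t + 1) i) =
      move (clusterDFS P) port (posAt port crash start t i)
        (outcome port crash start t i).1.tick (outcome port crash start t i).2 := by
  have hv : viewAt port crash start t (posAt port crash start t i) i =
      some (memAt port crash start t i) := viewAt_eq_some.2 ⟨ha, rfl, rfl⟩
  have hcomp : computeRound (G.degree (posAt port crash start t i))
      (viewAt port crash start t (posAt port crash start t i)) i =
      ((outcome port crash start t i).1.tick, (outcome port crash start t i).2) := by
    unfold computeRound
    simp only [hv, hclock, refresh_apply _ _ i, Option.map_some]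
    rfl
  have hhalt : (clusterDFS P).halted (memAt port crash start t i) = false := by
    show ((memAt port crash start t i).clock.val == P.totalRounds) = false
    rw [hclock]
    simpa using ht.ne
  have hstep : robotStep (clusterDFS P) port crash t (run (clusterDFS P) port crash start t) i =
      move (clusterDFS P) port (posAt port crash start t i)
        (computeRound (G.degree (posAt port crash start t i))
          (viewAt port crash start t (posAt port crash start t i)) i).1
        (computeRound (G.degree (posAt port crash start t i))
          (viewAt port crash start t (posAt port crash start t i)) i).2 := if_pos ⟨ha, hhalt⟩
  rw [hcomp] at hstep
  exact hstep

theorem step_halted {t : ℕ} {i : Fin P.k}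
    (hclock : (memAt port crash start t i).clock.val = P.totalRounds) :
    posAt port crash start (t + 1) i = posAt port crash start t i ∧
      memAt port crash start (t + 1) i = memAt port crash start t i := by
  have hhalt : (clusterDFS P).halted (memAt port crash start t i) = true := by
    show ((memAt port crash start t i).clock.val == P.totalRounds) = true
    simpa using hclock
  have hne : ¬ (Alive crash t i ∧ (clusterDFS P).halted (memAt port crash start t i) = false) := by
    simp [hhalt]
  have hstep : robotStep (clusterDFS P) port crash t (run (clusterDFS P) port crash start t) i =
      (posAt port crash start t i, memAt port crash start t i) := if_neg hne
  exact Prod.ext_iff.1 hstep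

/-- Moving changes only the entry port. -/
theorem move_fields (v : V) (s : Mem P) (o : Option ℕ) :
    let r := (move (clusterDFS P) port v s o).2
    r.clock = s.clock ∧ r.settled = s.settled ∧ r.cid = s.cid ∧ r.waiting = s.waiting ∧
      r.ptr = s.ptr := by
  cases o with
  | none => exact ⟨rfl, rfl, rfl, rfl, rfl⟩
  | some p =>
    unfold move
    dsimp only
    split_ifs
    · exact ⟨rfl, rfl, rfl, rfl, rfl⟩
    · exact ⟨rfl, rfl, rfl, rfl, rfl⟩

theorem move_congr (v : V) {s t : Mem P} (o : Option ℕ) (h : s.entry = t.entry) :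
    (move (clusterDFS P) port v s o).1 = (move (clusterDFS P) port v t o).1 ∧
      Mem.entry (move (clusterDFS P) port v s o).2 =
        Mem.entry (move (clusterDFS P) port v t o).2 := by
  cases o with
  | none => exact ⟨rfl, h⟩
  | some p =>
    unfold move
    dsimp only
    split_ifs
    · exact ⟨rfl, rfl⟩
    · exact ⟨rfl, h⟩

theorem move_link {v w : V} {p q : Fin P.Δ} (h : Link port P v p w q) (s : Mem P) :
    (move (clusterDFS P) port v s (some p.val)).1 = w ∧
      Mem.entry (move (clusterDFS P) port v s (some p.val)).2 = some q := by
  have hlt := h.lt_degree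
  obtain ⟨ha, h1, h2⟩ := h
  have he : (port v).symm ⟨p.val, hlt⟩ = ⟨w, ha⟩ := by
    rw [Equiv.symm_apply_eq]
    exact Fin.ext h1.symm
  simp only [move, hlt, dite_true]
  constructor
  · rw [he]
  · show (if h : _ then some (⟨_, h⟩ : Fin P.Δ) else none) = some q
    have : ((port ((port v).symm ⟨p.val, hlt⟩).1 ⟨v, ((port v).symm ⟨p.val, hlt⟩).2.symm⟩ : Fin _)
        : ℕ) = q := by
      rw [← h2]
      rw [he]
    rw [dif_pos (by rw [this]; exact q.isLt)]
    exact congrArg some (Fin.ext this)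

/-- The owner of a planned memory is alive and at the node. -/
theorem planAt_owner {t : ℕ} {v : V} {π : Plan P} (h : planAt port crash start t v = some π) :
    Alive crash t π.owner ∧ posAt port crash start t π.owner = v ∧
      π.mem.clock = (memAt port crash start t π.owner).clock ∧ π.mem.settled = true := by
  obtain ⟨r, x, -, h2, -, ⟨s, hs, hc⟩, -⟩ := plan_spec h
  obtain ⟨ha, hp, rfl⟩ := viewIn_eq_some.1 hs
  exact ⟨ha, hp, hc.trans (refreshed_clock _ _ _), h2⟩

theorem outcome_clock (t : ℕ) (i : Fin P.k) :
    (outcome port crash start t i).1.clock = (memAt port crash start t i).clock := by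
  unfold outcome
  by_cases h : ∃ π, planAt port crash start t (posAt port crash start t i) = some π ∧ i = π.owner
  · obtain ⟨π, hπ, ho⟩ := h
    rw [hπ, execute_of_owner ho, (planAt_owner hπ).2.2.1, ← ho]
  · push Not at h
    rw [(execute_of_unsettled h).2.2.1]
    exact refreshed_clock _ _ _

/-- The clocks of all robots that have not crashed agree. -/
theorem clock_eq (t : ℕ) {i : Fin P.k} (ha : Alive crash t i) :
    (memAt port crash start t i).clock.val = min t P.totalRounds := by
  induction t with
  | zero =>
    show ((0 : Fin (P.totalRounds + 1)) : ℕ) = _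
    simp
  | succ t ih =>
    have ih := ih ha.of_succ
    rcases lt_or_ge t P.totalRounds with ht | ht
    · rw [min_eq_left ht.le] at ih
      have h := step_eq ht ha.of_succ ih
      have h2 := (move_fields (port := port) (posAt port crash start t i)
        (outcome port crash start t i).1.tick (outcome port crash start t i).2).1
      rw [← h] at h2
      have h3 : (memAt port crash start (t + 1) i).clock = _ := h2
      rw [h3]
      show min ((outcome port crash start t i).1.clock.val + 1) P.totalRounds = _
      rw [outcome_clock, ih]
    · rw [min_eq_right ht] at ih
      rw [(step_halted ih).2, ih, min_eq_right (by omega)]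

theorem step {t : ℕ} (ht : t < P.totalRounds) {i : Fin P.k} (ha : Alive crash t i) :
    (posAt port crash start (t + 1) i, memAt port crash start (t + 1) i) =
      move (clusterDFS P) port (posAt port crash start t i)
        (outcome port crash start t i).1.tick (outcome port crash start t i).2 :=
  step_eq ht ha (by rw [clock_eq t ha, min_eq_left ht.le])

theorem step_fields {t : ℕ} (ht : t < P.totalRounds) {i : Fin P.k} (ha : Alive crash t i) :
    let m := memAt port crash start (t + 1) i
    let o := (outcome port crash start t i).1
    m.settled = o.settled ∧ m.cid = o.cid ∧ m.waiting = o.waiting ∧ m.ptr = o.ptr := by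
  have h2 := move_fields (port := port) (posAt port crash start t i)
    (outcome port crash start t i).1.tick (outcome port crash start t i).2
  rw [← step ht ha] at h2
  exact h2.2

/-- The owner of a plan stays, with the planned memory. -/
theorem step_owner {t : ℕ} (ht : t < P.totalRounds) {v : V} {π : Plan P}
    (h : planAt port crash start t v = some π) :
    posAt port crash start (t + 1) π.owner = v ∧
      (memAt port crash start (t + 1) π.owner).settled = true ∧
      (memAt port crash start (t + 1) π.owner).cid = π.mem.cid ∧
      (memAt port crash start (t + 1) π.owner).ptr = π.mem.ptr := by
  obtain ⟨ha, rfl, -, hs⟩ := planAt_owner h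
  have ho : outcome port crash start t π.owner = (π.mem, none) := by
    unfold outcome
    rw [h, execute_of_owner rfl]
  have hst := step (port := port) (start := start) ht ha
  have hf := step_fields (port := port) (start := start) ht ha
  rw [ho] at hst hf
  exact ⟨congrArg Prod.fst hst, hf.1.trans hs, hf.2.1, hf.2.2.2⟩

/-- A settled robot that is not the owner of a plan stays as it is. -/
theorem step_settled {t : ℕ} (ht : t < P.totalRounds) {i : Fin P.k} (ha : Alive crash t i)
    (hs : (memAt port crash start t i).settled = true)
    (h : ∀ π, planAt port crash start t (posAt port crash start t i) = some π → i ≠ π.owner) :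
    posAt port crash start (t + 1) i = posAt port crash start t i ∧
      (memAt port crash start (t + 1) i).settled = true ∧
      (memAt port crash start (t + 1) i).cid = (memIn port crash start t i).cid ∧
      (memAt port crash start (t + 1) i).ptr = (memIn port crash start t i).ptr := by
  have hs' : (memIn port crash start t i).settled = true := (memIn_settled t i).trans hs
  have ho : outcome port crash start t i = (memIn port crash start t i, none) := by
    unfold outcome
    rw [execute_of_settled h hs']
  have hst := step (port := port) (start := start) ht ha
  have hf := step_fields (port := port) (start := start) ht ha
  rw [ho] at hst hf
  exact ⟨congrArg Prod.fst hst, hf.1.trans hs', hf.2.1, hf.2.2.2⟩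

/-- A settled robot stays settled and does not move. -/
theorem settled_step {t : ℕ} (ht : t < P.totalRounds) {i : Fin P.k} (ha : Alive crash t i)
    (hs : (memAt port crash start t i).settled = true) :
    posAt port crash start (t + 1) i = posAt port crash start t i ∧
      (memAt port crash start (t + 1) i).settled = true := by
  by_cases h : ∃ π, planAt port crash start t (posAt port crash start t i) = some π ∧ i = π.owner
  · obtain ⟨π, hπ, ho⟩ := h
    have := step_owner ht hπ
    rw [← ho] at this
    exact ⟨this.1, this.2.1⟩
  · push Not at h
    have := step_settled ht ha hs h
    exact ⟨this.1, this.2.1⟩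

/-- A robot that is unsettled after the round is not the owner of a plan, was unsettled before, and
keeps its cluster. -/
theorem unsettled_step {t : ℕ} (ht : t < P.totalRounds) {i : Fin P.k} (ha : Alive crash t i)
    (hs : (memAt port crash start (t + 1) i).settled = false) :
    (∀ v π, planAt port crash start t v = some π → i ≠ π.owner) ∧
      (memAt port crash start t i).settled = false ∧
      (memAt port crash start (t + 1) i).cid = (memIn port crash start t i).cid := by
  have h : ∀ v π, planAt port crash start t v = some π → i ≠ π.owner := by
    rintro v π hπ rfl
    simp [(step_owner ht hπ).2.1] at hs
  refine ⟨h, ?_, ?_⟩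
  · by_contra hc
    simp [(settled_step ht ha (by simpa using hc)).2] at hs
  · rw [(step_fields ht ha).2.1]
    exact (execute_of_unsettled (h _)).2.1

/-- A newly settled robot is the owner of the plan for its node, where nobody was settled. -/
theorem newly_settled {t : ℕ} (ht : t < P.totalRounds) {i : Fin P.k} (ha : Alive crash t i)
    (h0 : (memAt port crash start t i).settled = false)
    (hs : (memAt port crash start (t + 1) i).settled = true) :
    ∃ π, planAt port crash start t (posAt port crash start t i) = some π ∧ i = π.owner ∧
      settler (viewIn port crash start t (posAt port crash start t i)) = none := by
  by_cases h : ∃ π, planAt port crash start t (posAt port crash start t i) = some π ∧ i = π.owner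
  · obtain ⟨π, hπ, ho⟩ := h
    refine ⟨π, hπ, ho, ?_⟩
    obtain ⟨r, x, -, -, -, -, h5, -⟩ := plan_spec hπ
    rcases h5 with ⟨h5, -⟩ | ⟨s, h5, -⟩
    · exact h5
    · obtain ⟨h6, h7⟩ := settler_eq_some h5
      obtain ⟨-, -, rfl⟩ := viewIn_eq_some.1 h6
      rw [← ho, memIn_settled, h0] at h7
      cases h7
  · push Not at h
    rw [(step_fields ht ha).1, outcome, (execute_of_unsettled h).1, memIn_settled, h0] at hs
    cases hs

/-- Settled robots are at distinct nodes. -/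
theorem settled_unique {t : ℕ} (ht : t ≤ P.totalRounds) {i j : Fin P.k} (hi : Alive crash t i)
    (hj : Alive crash t j) (hsi : (memAt port crash start t i).settled = true)
    (hsj : (memAt port crash start t j).settled = true)
    (hpos : posAt port crash start t i = posAt port crash start t j) : i = j := by
  induction t generalizing i j with
  | zero => cases hsi
  | succ t ih =>
    have ht' : t < P.totalRounds := ht
    -- A robot settles only where no settled robot is present, and settled robots do not move.
    have key : ∀ i j : Fin P.k, Alive crash t i → Alive crash t j →
        (memAt port crash start t i).settled = false →
        (memAt port crash start (t + 1) i).settled = true →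
        (memAt port crash start t j).settled = true →
        posAt port crash start (t + 1) i ≠ posAt port crash start (t + 1) j := by
      intro i j hi hj h0 h1 h2 hp
      obtain ⟨π, hπ, ho, hset⟩ := newly_settled ht' hi h0 h1
      have hpi := (step_owner ht' hπ).1
      rw [← ho, hp, (settled_step ht' hj h2).1] at hpi
      have := settled_of_settler_eq_none hset (viewIn_eq_some.2 ⟨hj, hpi, rfl⟩)
      rw [memIn_settled, h2] at this
      cases this
    cases h0i : (memAt port crash start t i).settled with
    | true =>
      cases h0j : (memAt port crash start t j).settled with
      | true =>
        refine ih ht'.le hi.of_succ hj.of_succ h0i h0j ?_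
        rwa [(settled_step ht' hi.of_succ h0i).1, (settled_step ht' hj.of_succ h0j).1] at hpos
      | false => exact absurd hpos.symm (key j i hj.of_succ hi.of_succ h0j hsj h0i)
    | false =>
      cases h0j : (memAt port crash start t j).settled with
      | true => exact absurd hpos (key i j hi.of_succ hj.of_succ h0i hsi h0j)
      | false =>
        -- Two robots that settle at the same node in the same round both own the single plan of
        -- that node.
        obtain ⟨π, hπ, ho, -⟩ := newly_settled ht' hi.of_succ h0i hsi
        obtain ⟨π', hπ', ho', -⟩ := newly_settled ht' hj.of_succ h0j hsj
        have h1 := (step_owner ht' hπ).1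
        have h2 := (step_owner ht' hπ').1
        rw [← ho] at h1
        rw [← ho'] at h2
        rw [← h1, hpos, h2, hπ'] at hπ
        cases hπ
        exact ho.trans ho'.symm

end Rounds

/-! ### Coherence of clusters within a phase. -/

section Phases

variable {V : Type*} [Fintype V] [DecidableEq V] {G : SimpleGraph V} [DecidableRel G.Adj]
  {P : Params} {port : PortLabelling G} {crash : Fin P.k → ℕ∞} {start : Fin P.k → V}

theorem memIn_of_mod_ne {t : ℕ} (ht : t % P.phaseLength ≠ 0) (i : Fin P.k) :
    memIn port crash start t i = memAt port crash start t i := by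
  simp [memIn, refreshed, ht]

theorem memIn_of_mod_eq {t : ℕ} (ht : t % P.phaseLength = 0) (i : Fin P.k) :
    memIn port crash start t i = (memAt port crash start t i).reset
      (maxUnsettledId (viewAt port crash start t (posAt port crash start t i))) := by
  simp [memIn, refreshed, ht]

/-- The cid of an unsettled robot at the start of a phase. -/
theorem memIn_cid_start {t : ℕ} (ht : t % P.phaseLength = 0) {i : Fin P.k}
    (hs : (memAt port crash start t i).settled = false) :
    (memIn port crash start t i).cid =
      maxUnsettledId (viewAt port crash start t (posAt port crash start t i)) := by
  rw [memIn_of_mod_eq ht]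
  simp [Mem.reset, hs]

variable (port crash start) in
/-- Robots of the same cluster are in the same place and in the same situation. -/
def Coherent (t : ℕ) : Prop :=
  ∀ i j, Alive crash t i → Alive crash t j → (memAt port crash start t i).settled = false →
    (memAt port crash start t j).settled = false →
    (memIn port crash start t i).cid = (memIn port crash start t j).cid →
    posAt port crash start t i = posAt port crash start t j ∧
      (memIn port crash start t i).entry = (memIn port crash start t j).entry ∧
      (memIn port crash start t i).waiting = (memIn port crash start t j).waiting

theorem coherent_start {t : ℕ} (ht : t % P.phaseLength = 0) : Coherent port crash start t := by
  intro i j hi hj hsi hsj hc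
  rw [memIn_cid_start ht hsi, memIn_cid_start ht hsj] at hc
  refine ⟨?_, by simp [memIn_of_mod_eq ht, Mem.reset], by simp [memIn_of_mod_eq ht, Mem.reset]⟩
  obtain ⟨a, ha, s, has, -⟩ := exists_maxUnsettledId (viewAt_eq_some.2 ⟨hi, rfl, rfl⟩) hsi
  obtain ⟨b, hb, s', hbs, -⟩ := exists_maxUnsettledId (viewAt_eq_some.2 ⟨hj, rfl, rfl⟩) hsj
  rw [ha, hb] at hc
  obtain rfl : a = b := by exact_mod_cast hc
  rw [← (viewAt_eq_some.1 has).2.1, ← (viewAt_eq_some.1 hbs).2.1]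

/-- Robots of one cluster face the same plan, and what `execute` does to non-owners depends only on
fields in which they agree. Crashes only remove robots. The conclusion concerns `memAt`, not
`memIn`, so that it also covers the last round of a phase, after which a reset follows. -/
theorem Coherent.step {t : ℕ} (h : Coherent port crash start t) (ht : t < P.totalRounds)
    {i j : Fin P.k} (hi : Alive crash (t + 1) i) (hj : Alive crash (t + 1) j)
    (hsi : (memAt port crash start (t + 1) i).settled = false)
    (hsj : (memAt port crash start (t + 1) j).settled = false)
    (hc : (memAt port crash start (t + 1) i).cid = (memAt port crash start (t + 1) j).cid) :
    posAt port crash start (t + 1) i = posAt port crash start (t + 1) j ∧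
      (memAt port crash start (t + 1) i).entry = (memAt port crash start (t + 1) j).entry ∧
      (memAt port crash start (t + 1) i).waiting = (memAt port crash start (t + 1) j).waiting := by
  obtain ⟨hi1, hi2, hi3⟩ := unsettled_step ht hi.of_succ hsi
  obtain ⟨hj1, hj2, hj3⟩ := unsettled_step ht hj.of_succ hsj
  rw [hi3, hj3] at hc
  obtain ⟨h1, h2, h3⟩ := h i j hi.of_succ hj.of_succ hi2 hj2 hc
  have hout : (outcome port crash start t i).1.waiting = (outcome port crash start t j).1.waiting ∧
      (outcome port crash start t i).2 = (outcome port crash start t j).2 := by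
    unfold outcome
    rw [h1]
    exact execute_congr (hi1 _) (hj1 _) (by rw [memIn_settled, memIn_settled, hi2, hj2]) hc h3
  have hentry : (outcome port crash start t i).1.entry = (outcome port crash start t j).1.entry := by
    unfold outcome
    rw [(execute_of_unsettled (hi1 _)).2.2.2, (execute_of_unsettled (hj1 _)).2.2.2, h2]
  have hsti := Prod.ext_iff.1 (Dispersion.step (port := port) (start := start) ht hi.of_succ)
  have hstj := Prod.ext_iff.1 (Dispersion.step (port := port) (start := start) ht hj.of_succ)
  dsimp only at hsti hstj
  obtain ⟨hm1, hm2⟩ := move_congr (port := port) (posAt port crash start t i)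
    (s := (outcome port crash start t i).1.tick) (t := (outcome port crash start t j).1.tick)
    (outcome port crash start t i).2 hentry
  refine ⟨?_, ?_, ?_⟩
  · rw [hsti.1, hstj.1, hm1, h1, hout.2]
  · rw [hsti.2, hstj.2, hm2, h1, hout.2]
  · rw [(step_fields ht hi.of_succ).2.2.1, (step_fields ht hj.of_succ).2.2.1, hout.1]

theorem mod_ne_zero {t s : ℕ} (ht : t % P.phaseLength = 0) (hs : s + 1 < P.phaseLength) :
    (t + s + 1) % P.phaseLength ≠ 0 := by
  rw [add_assoc, Nat.add_mod, ht, zero_add, Nat.mod_mod, Nat.mod_eq_of_lt hs]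
  omega

/-- Clusters stay coherent during a phase. -/
theorem coherent_phase {t : ℕ} (ht : t % P.phaseLength = 0)
    (hT : t + P.phaseLength ≤ P.totalRounds) {s : ℕ} (hs : s < P.phaseLength) :
    Coherent port crash start (t + s) := by
  induction s with
  | zero => exact coherent_start ht
  | succ s ih =>
    intro i j hi hj hsi hsj hc
    have hne := mod_ne_zero ht hs
    rw [← add_assoc] at *
    rw [memIn_of_mod_ne hne, memIn_of_mod_ne hne] at *
    exact (ih (by omega)).step (by omega) hi hj hsi hsj hc

/-- An unsettled robot was unsettled at the start of the phase and has kept its cluster. -/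
theorem unsettled_phase {t : ℕ} (ht : t % P.phaseLength = 0)
    (hT : t + P.phaseLength ≤ P.totalRounds) {s : ℕ} (hs : s < P.phaseLength) {i : Fin P.k}
    (hi : Alive crash (t + s) i) (hsi : (memAt port crash start (t + s) i).settled = false) :
    (memAt port crash start t i).settled = false ∧
      (memIn port crash start (t + s) i).cid = (memIn port crash start t i).cid := by
  induction s with
  | zero => exact ⟨hsi, rfl⟩
  | succ s ih =>
    have hne := mod_ne_zero ht hs
    rw [← add_assoc] at *
    obtain ⟨-, h2, h3⟩ := unsettled_step (by omega) hi.of_succ hsi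
    obtain ⟨h4, h5⟩ := ih (by omega) hi.of_succ h2
    exact ⟨h4, by rw [memIn_of_mod_ne hne, h3, h5]⟩

/-- The end of the phase needs its own statement: in round `t + P.phaseLength` the memory `memIn` is
already reset, while `memAt` still shows the old `cid`. -/
theorem unsettled_phase_end {t : ℕ} (ht : t % P.phaseLength = 0) (hL : 0 < P.phaseLength)
    (hT : t + P.phaseLength ≤ P.totalRounds) {i : Fin P.k}
    (hi : Alive crash (t + P.phaseLength) i)
    (hsi : (memAt port crash start (t + P.phaseLength) i).settled = false) :
    (memAt port crash start t i).settled = false ∧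
      (memAt port crash start (t + P.phaseLength) i).cid = (memIn port crash start t i).cid := by
  obtain ⟨L, hLs⟩ : ∃ L, P.phaseLength = L + 1 := ⟨P.phaseLength - 1, by omega⟩
  have e : t + P.phaseLength = t + L + 1 := by omega
  rw [e] at hi hsi ⊢
  have hlt : t + L < P.totalRounds := by omega
  obtain ⟨-, h2, h3⟩ := unsettled_step hlt hi.of_succ hsi
  obtain ⟨h4, h5⟩ := unsettled_phase (s := L) ht hT (by omega) hi.of_succ h2
  exact ⟨h4, h3.trans h5⟩

/-- No priority exceeds the largest identifier of a robot that was unsettled at the start of the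
phase. -/
theorem cid_le_phase {t : ℕ} (ht : t % P.phaseLength = 0)
    (hT : t + P.phaseLength ≤ P.totalRounds) {c : Fin P.k}
    (hc : ∀ i, Alive crash t i → (memAt port crash start t i).settled = false → i ≤ c)
    {s : ℕ} (hs : s < P.phaseLength) {i : Fin P.k} (hi : Alive crash (t + s) i) :
    (memIn port crash start (t + s) i).cid ≤ c := by
  induction s generalizing i with
  | zero =>
    cases hsi : (memAt port crash start t i).settled with
    | true => simp [memIn_of_mod_eq ht, Mem.reset, hsi]
    | false =>
      rw [add_zero, memIn_cid_start ht hsi]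
      obtain ⟨a, ha, s, has, hs⟩ := exists_maxUnsettledId (viewAt_eq_some.2 ⟨hi, rfl, rfl⟩) hsi
      obtain ⟨h1, -, rfl⟩ := viewAt_eq_some.1 has
      rw [add_zero] at ha
      rw [ha]
      exact_mod_cast hc a h1 hs
  | succ s ih =>
    have hne := mod_ne_zero ht hs
    rw [← add_assoc] at *
    have ht' : t + s < P.totalRounds := by omega
    rw [memIn_of_mod_ne hne, (step_fields ht' hi.of_succ).2.1]
    by_cases h : ∃ π, planAt port crash start (t + s) (posAt port crash start (t + s) i) = some π ∧
      i = π.owner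
    · obtain ⟨π, hπ, ho⟩ := h
      rw [outcome, hπ, execute_of_owner ho]
      obtain ⟨r, x, hx, -, h2, -⟩ := plan_spec hπ
      obtain ⟨h3, -, rfl⟩ := viewIn_eq_some.1 (explorer_eq_some hx).1
      rw [h2]
      exact ih (by omega) h3
    · push Not at h
      rw [outcome, (execute_of_unsettled h).2.1]
      exact ih (by omega) hi.of_succ

/-! ### The undisturbed search of the cluster of highest priority. -/

open Classical in
variable (port crash start) in
/-- The pointers at `v` in round `t` if `v` is in the possession of the cluster `c`. -/
noncomputable def ptrAt (c : Fin P.k) (t : ℕ) (v : V) : Option (Ptr P) :=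
  if h : ∃ o, Alive crash t o ∧ posAt port crash start t o = v ∧
      (memAt port crash start t o).settled = true ∧ (memIn port crash start t o).cid = c
    then some (memIn port crash start t h.choose).ptr else none

theorem ptrAt_eq_some {c : Fin P.k} {t : ℕ} (ht : t ≤ P.totalRounds) {v : V} {z : Ptr P} :
    ptrAt port crash start c t v = some z ↔
      ∃ o, Alive crash t o ∧ posAt port crash start t o = v ∧
        (memAt port crash start t o).settled = true ∧ (memIn port crash start t o).cid = c ∧
        (memIn port crash start t o).ptr = z := by
  unfold ptrAt
  constructor
  · intro h
    split_ifs at h with h'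
    cases h
    obtain ⟨h1, h2, h3, h4⟩ := h'.choose_spec
    exact ⟨_, h1, h2, h3, h4, rfl⟩
  · rintro ⟨o, h1, h2, h3, h4, rfl⟩
    have h' : ∃ o, Alive crash t o ∧ posAt port crash start t o = v ∧
      (memAt port crash start t o).settled = true ∧ (memIn port crash start t o).cid = c :=
      ⟨o, h1, h2, h3, h4⟩
    rw [dif_pos h']
    obtain ⟨k1, k2, k3, -⟩ := h'.choose_spec
    rw [settled_unique ht k1 h1 k3 h3 (k2.trans h2.symm)]

/-- The unsettled robot `i₀` possesses no node, so fewer than `P.k` nodes are possessed. This yields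
both an unvisited node and the bound on the moves. -/
theorem mem_image_of_ptrAt {c i₀ : Fin P.k} {t : ℕ} (ht : t ≤ P.totalRounds)
    (hs : (memAt port crash start t i₀).settled = false) {v : V}
    (hv : (ptrAt port crash start c t v).isSome) :
    v ∈ (Finset.univ.erase i₀).image (posAt port crash start t) := by
  obtain ⟨z, hz⟩ := Option.isSome_iff_exists.1 hv
  obtain ⟨o, -, h2, h3, -⟩ := (ptrAt_eq_some ht).1 hz
  refine Finset.mem_image.2 ⟨o, Finset.mem_erase.2 ⟨?_, Finset.mem_univ _⟩, h2⟩
  rintro rfl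
  rw [h3] at hs
  cases hs

theorem card_image_erase_lt (g : Fin P.k → V) (i₀ : Fin P.k) :
    ((Finset.univ.erase i₀).image g).card < P.k := by
  refine Finset.card_image_le.trans_lt ?_
  rw [Finset.card_erase_of_mem (Finset.mem_univ _), Finset.card_univ, Fintype.card_fin]
  have := i₀.isLt
  omega

/-- The exploring cluster of the highest priority follows the rules of `visit`. -/
theorem top_plan {c i₀ : Fin P.k} {t : ℕ} (ht : t < P.totalRounds)
    (hcoh : Coherent port crash start t)
    (hle : ∀ i, Alive crash t i → (memIn port crash start t i).cid ≤ c)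
    (ha : Alive crash t i₀) (hs : (memAt port crash start t i₀).settled = false)
    (hc : (memIn port crash start t i₀).cid = c)
    (hw : (memIn port crash start t i₀).waiting = false) :
    topPriority (viewIn port crash start t (posAt port crash start t i₀)) = c ∧
    ∃ π, planAt port crash start t (posAt port crash start t i₀) = some π ∧ π.mem.cid = c ∧
      (π.mem.ptr, π.exit) = visit (G.degree (posAt port crash start t i₀))
        (memIn port crash start t i₀).entry
        (ptrAt port crash start c t (posAt port crash start t i₀)) := by
  set u := posAt port crash start t i₀
  have hview : viewIn port crash start t u i₀ = some (memIn port crash start t i₀) :=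
    viewIn_eq_some.2 ⟨ha, rfl, rfl⟩
  have hs' : (memIn port crash start t i₀).settled = false := (memIn_settled t i₀).trans hs
  have htop : topPriority (viewIn port crash start t u) = c := by
    refine le_antisymm (topPriority_le fun j s hj _ => ?_) (hc ▸ le_topPriority hview hs')
    obtain ⟨h1, -, rfl⟩ := viewIn_eq_some.1 hj
    exact hle j h1
  refine ⟨htop, ?_⟩
  obtain ⟨⟨r, x⟩, hx⟩ := Option.ne_none_iff_exists'.1
    (explorer_ne_none hview hs' hw (hc.trans htop.symm))
  obtain ⟨hx1, hx2, hx3, hx4⟩ := explorer_eq_some hx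
  obtain ⟨hr1, hr2, rfl⟩ := viewIn_eq_some.1 hx1
  rw [htop] at hx4
  obtain ⟨π, hπ⟩ := plan_ne_none (d := G.degree u) hx fun j s hj _ => by
    obtain ⟨h1, -, rfl⟩ := viewIn_eq_some.1 hj
    exact hx4 ▸ hle j h1
  obtain ⟨r', x', hx', h2, h3, -, h5, h6⟩ := plan_spec hπ
  rw [hx] at hx'
  cases hx'
  refine ⟨π, hπ, h3.trans hx4, ?_⟩
  rw [h6]
  rw [memIn_settled] at hx2
  -- The explorer `r` need not be `i₀`, but coherence gives both the same entry port.
  rw [(hcoh r i₀ hr1 ha hx2 hs (hx4.trans hc.symm)).2.1]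
  congr 1
  rcases h5 with ⟨h5, -⟩ | ⟨s, h5, -⟩
  · rw [h5]
    cases hp : ptrAt port crash start c t u with
    | none => rfl
    | some z =>
      obtain ⟨o, k1, k2, k3, -⟩ := (ptrAt_eq_some ht.le).1 hp
      have := settled_of_settler_eq_none h5 (viewIn_eq_some.2 ⟨k1, k2, rfl⟩)
      rw [memIn_settled, k3] at this
      cases this
  · rw [h5]
    obtain ⟨k1, k2⟩ := settler_eq_some h5
    obtain ⟨k3, k4, rfl⟩ := viewIn_eq_some.1 k1
    rw [memIn_settled] at k2
    dsimp only
    split_ifs with hcid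
    · exact ((ptrAt_eq_some ht.le).2 ⟨_, k3, k4, k2, hcid.trans hx4, rfl⟩).symm
    · cases hp : ptrAt port crash start c t u with
      | none => rfl
      | some z =>
        obtain ⟨o, l1, l2, l3, l4, -⟩ := (ptrAt_eq_some ht.le).1 hp
        obtain rfl := settled_unique ht.le l1 k3 l3 k2 (l2.trans k4.symm)
        exact absurd (l4.trans hx4.symm) hcid

/-- In a round without crashes, the possessions of the cluster of the highest priority change only
at its own node. -/
theorem ptrAt_succ {c i₀ : Fin P.k} {t : ℕ} (ht : t < P.totalRounds)
    (hmod : (t + 1) % P.phaseLength ≠ 0)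
    (hcrash : ∀ i, Alive crash t i → Alive crash (t + 1) i)
    (hcoh : Coherent port crash start t)
    (hle : ∀ i, Alive crash t i → (memIn port crash start t i).cid ≤ c)
    (ha : Alive crash t i₀) (hs : (memAt port crash start t i₀).settled = false)
    (hc : (memIn port crash start t i₀).cid = c) {π : Plan P}
    (hπ : planAt port crash start t (posAt port crash start t i₀) = some π) (hπc : π.mem.cid = c) :
    ptrAt port crash start c (t + 1) =
      Function.update (ptrAt port crash start c t) (posAt port crash start t i₀)
        (some π.mem.ptr) := by
  -- By coherence all unsettled robots of the cluster `c` are with `i₀`, so a plan at another node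
  -- has an explorer of priority below `c`. It neither assigns `c` to its owner nor takes a node
  -- away from `c`.
  have hother : ∀ v π', v ≠ posAt port crash start t i₀ →
      planAt port crash start t v = some π' → π'.mem.cid ≠ c ∧
        (memIn port crash start t π'.owner).cid ≠ c ∨
        π'.mem.cid ≠ c ∧ (memAt port crash start t π'.owner).settled = false := by
    intro v π' hv hπ'
    obtain ⟨r, x, hx, h2, h3, -, h5, -⟩ := plan_spec hπ'
    obtain ⟨hx1, hx2, hx3, hx4⟩ := explorer_eq_some hx
    obtain ⟨hr1, hr2, rfl⟩ := viewIn_eq_some.1 hx1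
    rw [memIn_settled] at hx2
    have hne : (memIn port crash start t r).cid ≠ c := fun e =>
      hv (hr2.symm.trans (hcoh r i₀ hr1 ha hx2 hs (e.trans hc.symm)).1)
    rcases h5 with ⟨-, h5⟩ | ⟨s, h5, h6⟩
    · refine .inr ⟨h3 ▸ hne, ?_⟩
      rwa [h5]
    · obtain ⟨-, -, rfl⟩ := viewIn_eq_some.1 (settler_eq_some h5).1
      refine .inl ⟨h3 ▸ hne, (h6.trans_lt (lt_of_le_of_ne (hle r hr1) hne)).ne⟩
  funext v
  by_cases hv : v = posAt port crash start t i₀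
  · subst hv
    rw [Function.update_self, ptrAt_eq_some (Nat.succ_le_of_lt ht)]
    obtain ⟨h1, h2, h3, h4⟩ := step_owner ht hπ
    refine ⟨π.owner, hcrash _ (planAt_owner hπ).1, h1, h2, ?_, ?_⟩
    · rw [memIn_of_mod_ne hmod, h3, hπc]
    · rw [memIn_of_mod_ne hmod, h4]
  · rw [Function.update_of_ne hv]
    refine Option.ext fun z => ?_
    rw [ptrAt_eq_some (Nat.succ_le_of_lt ht), ptrAt_eq_some ht.le]
    simp only [memIn_of_mod_ne hmod]
    constructor
    · rintro ⟨o, h1, h2, h3, h4, h5⟩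
      have hnot : ∀ v' π', planAt port crash start t v' = some π' → o ≠ π'.owner := by
        rintro v' π' hπ' rfl
        obtain ⟨k1, k2, k3, k4⟩ := step_owner ht hπ'
        obtain rfl := k1.symm.trans h2
        rcases hother v' π' hv hπ' with ⟨k, -⟩ | ⟨k, -⟩ <;> exact k (k3.symm.trans h4)
      cases ho : (memAt port crash start t o).settled with
      | false =>
        obtain ⟨π', hπ', k, -⟩ := newly_settled ht h1.of_succ ho h3
        exact absurd k (hnot _ _ hπ')
      | true =>
        obtain ⟨k1, k2, k3, k4⟩ := step_settled ht h1.of_succ ho (hnot _)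
        exact ⟨o, h1.of_succ, k1.symm.trans h2, ho, k3.symm.trans h4, k4.symm.trans h5⟩
    · rintro ⟨o, h1, h2, h3, h4, h5⟩
      have hnot : ∀ π', planAt port crash start t (posAt port crash start t o) = some π' →
          o ≠ π'.owner := by
        rintro π' hπ' rfl
        rcases hother _ π' (h2 ▸ hv) hπ' with ⟨-, k⟩ | ⟨-, k⟩
        · exact k h4
        · rw [h3] at k
          cases k
      obtain ⟨k1, k2, k3, k4⟩ := step_settled ht h1 h3 hnot
      exact ⟨o, hcrash o h1, k1.trans h2, k2, k3.trans h4, k4.trans h5⟩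

/-- In a phase without crashes, all robots of the cluster of the highest priority settle. -/
theorem top_cluster_settles (hm : P.m = G.edgeFinset.card) (hΔ : P.Δ = G.maxDegree)
    (hG : G.Connected) (hk : P.k ≤ Fintype.card V) {t : ℕ} (ht : t % P.phaseLength = 0)
    (hL : 0 < P.phaseLength) (hT : t + P.phaseLength ≤ P.totalRounds)
    (hcrash : ∀ i, Alive crash t i → Alive crash (t + P.phaseLength) i) {c i₀ : Fin P.k}
    (hcmax : ∀ i, Alive crash t i → (memAt port crash start t i).settled = false → i ≤ c)
    (hc : Alive crash t c) (hcs : (memAt port crash start t c).settled = false)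
    (hpos : posAt port crash start t i₀ = posAt port crash start t c)
    (ha : Alive crash (t + P.phaseLength) i₀) :
    (memAt port crash start (t + P.phaseLength) i₀).settled = true := by
  by_contra hend
  have hend : (memAt port crash start (t + P.phaseLength) i₀).settled = false := by
    simpa using hend
  have halive : ∀ s ≤ P.phaseLength, Alive crash (t + s) i₀ := fun s hs =>
    ha.mono (by omega)
  have huns : ∀ s ≤ P.phaseLength, (memAt port crash start (t + s) i₀).settled = false := by
    intro s hs
    induction hs using Nat.decreasingInduction with
    | self => exact hend
    | of_succ s hs ih =>
      exact (unsettled_step (by omega) (halive s hs.le) (by rw [add_assoc]; exact ih)).2.1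
  have hcid : ∀ s < P.phaseLength, (memIn port crash start (t + s) i₀).cid = c := by
    intro s hs
    rw [(unsettled_phase ht hT hs (halive s hs.le) (huns s hs.le)).2,
      memIn_cid_start ht (huns 0 (Nat.zero_le _)), hpos]
    obtain ⟨a, h1, s', h2, h3⟩ := exists_maxUnsettledId
      (viewAt_eq_some.2 ⟨hc, rfl, rfl⟩) hcs
    obtain ⟨h4, -, rfl⟩ := viewAt_eq_some.1 h2
    refine le_antisymm ?_ (le_maxUnsettledId (viewAt_eq_some.2 ⟨hc, rfl, rfl⟩) hcs)
    rw [h1]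
    exact_mod_cast hcmax a h4 h3
  have hle : ∀ s < P.phaseLength, ∀ i, Alive crash (t + s) i →
      (memIn port crash start (t + s) i).cid ≤ c := fun s hs i hi =>
    cid_le_phase ht hT hcmax hs hi
  -- The cluster never waits: after `s` rounds of the phase it has made exactly `s` moves.
  have key : ∀ s < P.phaseLength,
      Searching port (ptrAt port crash start c (t + s)) (posAt port crash start (t + s) i₀)
        (memIn port crash start (t + s) i₀).entry s ∧
      (memIn port crash start (t + s) i₀).waiting = false := by
    intro s hs
    induction s with
    | zero =>
      refine ⟨.start (fun v => ?_) ?_ rfl, ?_⟩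
      · cases hp : ptrAt port crash start c (t + 0) v with
        | none => rfl
        | some z =>
          obtain ⟨o, -, -, h3, h4, -⟩ := (ptrAt_eq_some (by omega)).1 hp
          rw [add_zero, memIn_of_mod_eq ht] at h4
          rw [add_zero] at h3
          simp [Mem.reset, h3] at h4
      · rw [add_zero, memIn_of_mod_eq ht]
        rfl
      · rw [add_zero, memIn_of_mod_eq ht]
        rfl
    | succ s ih =>
      have hs' : s < P.phaseLength := by omega
      obtain ⟨hsearch, hw⟩ := ih hs'
      have ht' : t + s < P.totalRounds := by omega
      have hmod := mod_ne_zero ht hs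
      have hcoh : Coherent port crash start (t + s) := coherent_phase ht hT hs'
      obtain ⟨htop, π, hπ, hπc, hvisit⟩ := top_plan ht' hcoh (hle s hs') (halive s hs'.le)
        (huns s hs'.le) (hcid s hs') hw
      have hptr := ptrAt_succ ht' hmod
        (fun i hi => (hcrash i (hi.mono (by omega))).mono (by omega)) hcoh (hle s hs')
        (halive s hs'.le) (huns s hs'.le) (hcid s hs') hπ hπc
      have huns' : (memAt port crash start (t + s + 1) i₀).settled = false := huns (s + 1) hs.le
      obtain ⟨hv1, hv2⟩ := Prod.ext_iff.1 hvisit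
      dsimp only at hv1 hv2
      rw [hv1] at hptr
      -- If all nodes were possessed, there would be at least as many settled robots other than `i₀`
      -- as nodes, against `hk`.
      have hfree : ∃ v, ptrAt port crash start c (t + s + 1) v = none := by
        by_contra hcon
        push Not at hcon
        have hsub : (Finset.univ : Finset V) ⊆
            (Finset.univ.erase i₀).image (posAt port crash start (t + s + 1)) := fun v _ =>
          mem_image_of_ptrAt (by omega) huns' (Option.ne_none_iff_isSome.1 (hcon v))
        have := Finset.card_le_card hsub
        rw [Finset.card_univ] at this
        have := card_image_erase_lt (posAt port crash start (t + s + 1)) i₀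
        omega
      obtain ⟨p, w, r, hp, hl, hnew⟩ := hsearch.step hΔ hG hptr hfree
      have hne := (unsettled_step ht' (halive s hs'.le) huns').1 _ π hπ
      have hout : outcome port crash start (t + s) i₀ =
          (memIn port crash start (t + s) i₀, some p.val) := by
        unfold outcome
        rw [hπ]
        exact execute_exit hne ((memIn_settled _ _).trans (huns s hs'.le)) hw (hv2.trans hp)
          ((hcid s hs').trans htop.symm)
      have hst := Prod.ext_iff.1
        (step (port := port) (start := start) ht' (halive s hs'.le))
      have hf := (step_fields (port := port) (start := start) ht' (halive s hs'.le)).2.2.1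
      rw [hout] at hst hf
      dsimp only at hst hf
      obtain ⟨hm1, hm2⟩ := move_link hl (memIn port crash start (t + s) i₀).tick
      rw [← add_assoc, memIn_of_mod_ne hmod, hst.1, hm1]
      refine ⟨?_, hf.trans hw⟩
      rw [show (memAt port crash start (t + s + 1) i₀).entry = some r by rw [hst.2]; exact hm2]
      exact hnew
  -- With `μ` the minimum in the definition of the phase length, this says `8 * μ - 1 ≤ 4 * μ + 1`,
  -- which is impossible since `hL` gives `μ ≥ 1`.
  have hlast := (key (P.phaseLength - 1) (by omega)).1.le hΔ
    (fun v hv => mem_image_of_ptrAt (by omega) (huns _ (by omega)) hv)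
    (card_image_erase_lt _ i₀).le
  have hdef : P.phaseLength = 8 * min P.m (min (P.k * P.Δ) (P.k ^ 2)) := rfl
  rw [hm] at hdef
  omega

/-! ### Counting clusters over the phases. -/

open Classical in
variable (port crash start) in
/-- The number of nodes at which there are unsettled robots after `t` rounds. -/
noncomputable def clusterCount (t : ℕ) : ℕ :=
  ((Finset.univ.filter fun i => Alive crash t i ∧ (memAt port crash start t i).settled = false).image
    (posAt port crash start t)).card

theorem settled_of_clusterCount_eq_zero {t : ℕ} (h : clusterCount port crash start t = 0)
    {i : Fin P.k} (hi : Alive crash t i) : (memAt port crash start t i).settled = true := by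
  classical
  by_contra hs
  unfold clusterCount at h
  rw [Finset.card_eq_zero, Finset.image_eq_empty, Finset.filter_eq_empty_iff] at h
  exact h (Finset.mem_univ i) ⟨hi, by simpa using hs⟩

/-- Clusters do not split during a phase; hence their number is bounded by the number of nodes where
those which do not settle completely started. -/
theorem clusterCount_le {t : ℕ} (ht : t % P.phaseLength = 0) (hL : 0 < P.phaseLength)
    (hT : t + P.phaseLength ≤ P.totalRounds) {S : Finset V}
    (hS : ∀ i, Alive crash (t + P.phaseLength) i →
      (memAt port crash start (t + P.phaseLength) i).settled = false →
      posAt port crash start t i ∈ S) :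
    clusterCount port crash start (t + P.phaseLength) ≤ S.card := by
  classical
  obtain ⟨L, hLs⟩ : ∃ L, P.phaseLength = L + 1 := ⟨P.phaseLength - 1, by omega⟩
  unfold clusterCount
  -- A final node is related to the nodes where its unsettled robots started the phase. Robots from
  -- one starting node share a `cid`, hence end at one node.
  refine Finset.card_le_card_of_forall_subsingleton
    (fun v u => ∃ i, Alive crash (t + P.phaseLength) i ∧
      (memAt port crash start (t + P.phaseLength) i).settled = false ∧
      posAt port crash start (t + P.phaseLength) i = v ∧ posAt port crash start t i = u) ?_ ?_
  · intro v hv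
    obtain ⟨i, hi, rfl⟩ := Finset.mem_image.1 hv
    obtain ⟨-, h1, h2⟩ := Finset.mem_filter.1 hi
    exact ⟨_, hS i h1 h2, i, h1, h2, rfl, rfl⟩
  · rintro u - v ⟨-, i, hi, hsi, rfl, hui⟩ v' ⟨-, j, hj, hsj, rfl, huj⟩
    obtain ⟨hi1, hi2⟩ := unsettled_phase_end ht hL hT hi hsi
    obtain ⟨hj1, hj2⟩ := unsettled_phase_end ht hL hT hj hsj
    rw [memIn_cid_start ht hi1, hui] at hi2
    rw [memIn_cid_start ht hj1, huj] at hj2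
    have hcoh : Coherent port crash start (t + L) := coherent_phase ht hT (by omega)
    have e : t + P.phaseLength = t + L + 1 := by omega
    have hc := hi2.trans hj2.symm
    rw [e] at hi hj hsi hsj hc ⊢
    exact (hcoh.step (by omega) hi hj hsi hsj hc).1

theorem clusterCount_antitone {t : ℕ} (ht : t % P.phaseLength = 0) (hL : 0 < P.phaseLength)
    (hT : t + P.phaseLength ≤ P.totalRounds) :
    clusterCount port crash start (t + P.phaseLength) ≤ clusterCount port crash start t := by
  classical
  refine clusterCount_le ht hL hT fun i hi hs => Finset.mem_image.2 ⟨i, ?_, rfl⟩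
  exact Finset.mem_filter.2 ⟨Finset.mem_univ _, hi.mono (by omega),
    (unsettled_phase_end ht hL hT hi hs).1⟩

/-- By `top_cluster_settles`, no robot left unsettled started at the node of the largest unsettled
identifier, so this node can be erased from the set in `clusterCount_le`. -/
theorem clusterCount_lt (hm : P.m = G.edgeFinset.card) (hΔ : P.Δ = G.maxDegree)
    (hG : G.Connected) (hk : P.k ≤ Fintype.card V) {t : ℕ} (ht : t % P.phaseLength = 0)
    (hL : 0 < P.phaseLength) (hT : t + P.phaseLength ≤ P.totalRounds)
    (hcrash : ∀ i, Alive crash t i → Alive crash (t + P.phaseLength) i)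
    (h0 : clusterCount port crash start t ≠ 0) :
    clusterCount port crash start (t + P.phaseLength) < clusterCount port crash start t := by
  classical
  set U := Finset.univ.filter fun i =>
    Alive crash t i ∧ (memAt port crash start t i).settled = false with hU
  have hcount : clusterCount port crash start t = (U.image (posAt port crash start t)).card := by
    unfold clusterCount
    congr!
  have hne : U.Nonempty := by
    rw [Finset.nonempty_iff_ne_empty]
    intro e
    rw [hcount, e] at h0
    simp at h0
  have hcU := U.max'_mem hne
  set c := U.max' hne
  obtain ⟨-, hc1, hc2⟩ := Finset.mem_filter.1 hcU
  rw [hcount]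
  refine (clusterCount_le ht hL hT
    (S := (U.image (posAt port crash start t)).erase (posAt port crash start t c)) ?_).trans_lt
    (Finset.card_erase_lt_of_mem (Finset.mem_image_of_mem _ hcU))
  intro i hi hs
  refine Finset.mem_erase.2 ⟨fun hpos => ?_, Finset.mem_image_of_mem _ (Finset.mem_filter.2
    ⟨Finset.mem_univ _, hi.mono (by omega), (unsettled_phase_end ht hL hT hi hs).1⟩)⟩
  have := top_cluster_settles hm hΔ hG hk ht hL hT hcrash (c := c)
    (fun j h1 h2 => U.le_max' j (Finset.mem_filter.2 ⟨Finset.mem_univ _, h1, h2⟩)) hc1 hc2 hpos hi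
  rw [hs] at this
  cases this

open Classical in
/-- Each phase without crashes decreases the number of clusters. -/
theorem clusterCount_phase (hm : P.m = G.edgeFinset.card) (hΔ : P.Δ = G.maxDegree)
    (hG : G.Connected) (hk : P.k ≤ Fintype.card V) (hL : 0 < P.phaseLength) {l : ℕ}
    (hl : clusterCount port crash start 0 ≤ l) {n : ℕ} (hn : n ≤ P.l + P.f) :
    clusterCount port crash start (n * P.phaseLength) = 0 ∨
      clusterCount port crash start (n * P.phaseLength) + n ≤
        l + (Finset.univ.filter fun i => ¬ Alive crash (n * P.phaseLength) i).card := by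
  induction n with
  | zero =>
    right
    rw [zero_mul]
    omega
  | succ n ih =>
    have ih := ih (by omega)
    have ht : n * P.phaseLength % P.phaseLength = 0 := Nat.mul_mod_left _ _
    have hT : n * P.phaseLength + P.phaseLength ≤ P.totalRounds := by
      rw [← Nat.succ_mul]
      exact Nat.mul_le_mul_right _ hn
    rw [Nat.succ_mul]
    have hanti := clusterCount_antitone (port := port) (crash := crash) (start := start) ht hL hT
    by_cases h0 : clusterCount port crash start (n * P.phaseLength) = 0
    · left
      omega
    have ih := ih.resolve_left h0
    right
    have hsub : (Finset.univ.filter fun i => ¬ Alive crash (n * P.phaseLength) i) ⊆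
        Finset.univ.filter fun i => ¬ Alive crash (n * P.phaseLength + P.phaseLength) i :=
      fun i hi => Finset.mem_filter.2 ⟨Finset.mem_univ _, fun h =>
        (Finset.mem_filter.1 hi).2 (h.mono (by omega))⟩
    -- Without a crash in the phase the left side is kept from growing by the loss of a cluster;
    -- with a crash the right side grows.
    by_cases hcrash : ∀ i, Alive crash (n * P.phaseLength) i →
        Alive crash (n * P.phaseLength + P.phaseLength) i
    · have := clusterCount_lt (port := port) (start := start) hm hΔ hG hk ht hL hT hcrash h0
      have := Finset.card_le_card hsub
      omega
    · push Not at hcrash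
      obtain ⟨i, hi1, hi2⟩ := hcrash
      have := Finset.card_lt_card (hsub.ssubset_of_mem_notMem (a := i)
        (Finset.mem_filter.2 ⟨Finset.mem_univ _, hi2⟩) (by simp [hi1]))
      omega

theorem posAt_of_totalRounds_le {t : ℕ} (ht : P.totalRounds ≤ t) {i : Fin P.k}
    (hi : Alive crash t i) :
    posAt port crash start t i = posAt port crash start P.totalRounds i := by
  induction t, ht using Nat.le_induction with
  | base => rfl
  | succ t ht ih =>
    rw [← ih hi.of_succ]
    exact (step_halted (by rw [clock_eq t hi.of_succ, min_eq_right ht])).1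

/-- If there is an edge, all factors are positive unless `P.k = 0`; without edges a connected graph
has a single node. Phases of length zero thus occur only with at most one robot, when distinctness
of positions is trivial. -/
theorem phaseLength_pos_or_le_one (hm : P.m = G.edgeFinset.card) (hΔ : P.Δ = G.maxDegree)
    (hG : G.Connected) (hk : P.k ≤ Fintype.card V) : 0 < P.phaseLength ∨ P.k ≤ 1 := by
  by_cases h : ∃ u v, G.Adj u v
  · obtain ⟨u, v, huv⟩ := h
    rcases Nat.eq_zero_or_pos P.k with h0 | h0
    · omega
    left
    have h1 : 0 < P.m := hm ▸ Finset.card_pos.2 ⟨s(u, v), by simpa using huv⟩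
    have h2 : 0 < P.Δ := by
      rw [hΔ]
      refine lt_of_lt_of_le ?_ (G.degree_le_maxDegree u)
      exact (G.degree_pos_iff_exists_adj u).2 ⟨v, huv⟩
    unfold Params.phaseLength
    positivity
  · right
    push Not at h
    refine hk.trans (Fintype.card_le_one_iff.2 fun u v => ?_)
    obtain ⟨W⟩ := hG.preconnected u v
    cases W with
    | nil => rfl
    | cons hadj _ => exact absurd hadj (h _ _)

/-- The algorithm achieves dispersion. -/
theorem dispersed (hm : P.m = G.edgeFinset.card) (hΔ : P.Δ = G.maxDegree)
    (hG : G.Connected) (hk : P.k ≤ Fintype.card V) (hl : (Finset.univ.image start).card ≤ P.l)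
    (hf : {i | crash i ≠ ⊤}.ncard ≤ P.f) {T : ℕ} (hT : P.totalRounds ≤ T) :
    DispersedWithin (clusterDFS P) port crash start T := by
  classical
  intro t ht
  refine ⟨fun i hi => ⟨?_, ?_⟩, fun i j hi hj hpos => ?_⟩
  · show ((memAt port crash start t i).clock.val == P.totalRounds) = true
    rw [clock_eq t hi, min_eq_right (hT.trans ht), beq_self_eq_true]
  · show posAt port crash start t i = posAt port crash start T i
    rw [posAt_of_totalRounds_le (hT.trans ht) hi, posAt_of_totalRounds_le hT (hi.mono ht)]
  · change posAt port crash start t i = posAt port crash start t j at hpos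
    rcases phaseLength_pos_or_le_one hm hΔ hG hk with hL | hL
    · rw [posAt_of_totalRounds_le (hT.trans ht) hi, posAt_of_totalRounds_le (hT.trans ht) hj] at hpos
      have hi' := hi.mono (hT.trans ht)
      have hj' := hj.mono (hT.trans ht)
      have h0 : clusterCount port crash start P.totalRounds = 0 := by
        have hcl : clusterCount port crash start 0 ≤ P.l :=
          (Finset.card_le_card (Finset.image_subset_image (Finset.filter_subset _ _))).trans hl
        have hcr : (Finset.univ.filter fun i => ¬ Alive crash P.totalRounds i).card ≤ P.f := by
          rw [← Set.ncard_coe_finset]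
          refine (Set.ncard_le_ncard (fun i hi => ?_) (Set.toFinite _)).trans hf
          simp only [Finset.coe_filter, Finset.mem_univ, true_and, Set.mem_ofPred_eq] at hi
          intro e
          exact hi (by simp [Alive, e])
        have := clusterCount_phase hm hΔ hG hk hL hcl le_rfl
        change clusterCount port crash start P.totalRounds = 0 ∨
          clusterCount port crash start P.totalRounds + (P.l + P.f) ≤ P.l +
            (Finset.univ.filter fun i => ¬ Alive crash P.totalRounds i).card at this
        omega
      exact settled_unique le_rfl hi' hj' (settled_of_clusterCount_eq_zero h0 hi')
        (settled_of_clusterCount_eq_zero h0 hj') hpos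
    · apply Fin.ext
      omega

end Phases

/-! ### The memory bound. -/

theorem card_mem (P : Params) : Fintype.card (Mem P) =
    (P.totalRounds + 1) * (2 * ((P.k + 1) * ((P.Δ + 1) * ((P.Δ + 1) * (2 * ((P.Δ + 1) * 2)))))) := by
  rw [Fintype.card_congr (Mem.equivTuple P)]
  simp

/-- The robots need logarithmic memory. -/
theorem memoryBits_le {P : Params} (hl : P.l ≤ P.k) (hf : P.f ≤ P.k) :
    (clusterDFS P).memoryBits ≤ 20 * (Nat.log 2 (P.k + P.Δ) + 1) := by
  have hcard : (clusterDFS P).memoryBits = Nat.clog 2 (P.k * Fintype.card (Mem P)) := by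
    unfold RobotAlgorithm.memoryBits
    congr!
  rw [hcard, card_mem]
  rcases Nat.eq_zero_or_pos P.k with h0 | h0
  · simp [h0]
  set n := P.k + P.Δ with hn
  have hn1 : 1 ≤ n := by omega
  -- There are at most `2 * n` phases of at most `8 * n ^ 2` rounds; the additional clock value
  -- makes 17.
  have htotal : P.totalRounds + 1 ≤ 17 * n ^ 3 := by
    have h1 : P.phaseLength ≤ 8 * n ^ 2 := by
      have : P.k ^ 2 ≤ n ^ 2 := Nat.pow_le_pow_left (by omega) 2
      unfold Params.phaseLength
      omega
    have h2 : P.totalRounds ≤ (2 * n) * (8 * n ^ 2) := Nat.mul_le_mul (by omega) h1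
    have h3 : 1 ≤ n ^ 3 := Nat.one_le_pow _ _ hn1
    nlinarith
  have hk : P.k + 1 ≤ 2 * n := by omega
  have hΔ : P.Δ + 1 ≤ n := by omega
  -- The exponent 8 collects the identifier, the clock with exponent 3, `cid` and three ports. The
  -- constant `17 * 2 ^ 4 = 272` is rounded up to `2 ^ 12`, so that `12 + 8 = 20` is the final
  -- factor.
  have hbound : P.k * ((P.totalRounds + 1) *
      (2 * ((P.k + 1) * ((P.Δ + 1) * ((P.Δ + 1) * (2 * ((P.Δ + 1) * 2))))))) ≤ 2 ^ 12 * n ^ 8 := by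
    calc _ ≤ n * ((17 * n ^ 3) * (2 * ((2 * n) * (n * (n * (2 * (n * 2))))))) := by
          gcongr
          omega
      _ = 272 * n ^ 8 := by ring
      _ ≤ 2 ^ 12 * n ^ 8 := Nat.mul_le_mul_right _ (by norm_num)
  refine Nat.clog_le_of_le_pow (hbound.trans ?_)
  have hlog : n ≤ 2 ^ (Nat.log 2 n + 1) := (Nat.lt_pow_succ_log_self (by norm_num) n).le
  calc 2 ^ 12 * n ^ 8 ≤ 2 ^ 12 * (2 ^ (Nat.log 2 n + 1)) ^ 8 := by gcongr
    _ = 2 ^ (12 + (Nat.log 2 n + 1) * 8) := by rw [← pow_mul, ← pow_add]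
    _ ≤ 2 ^ (20 * (Nat.log 2 n + 1)) := Nat.pow_le_pow_right (by norm_num) (by omega)

end Dispersion

theorem mainTheorem2 :
    ∃ C : ℕ,
      ∀ (V : Type*) [Fintype V] [DecidableEq V] (G : SimpleGraph V) [DecidableRel G.Adj]
        (port : Dispersion.PortLabelling G) (k f l : ℕ)
        (start : Fin k → V) (crash : Fin k → ℕ∞),
        G.Connected →
        k ≤ Fintype.card V →
        f ≤ k →
        (Finset.univ.image start).card = l →
        {i : Fin k | crash i ≠ ⊤}.ncard ≤ f →
        Dispersion.DispersedWithin
          (Dispersion.clusterDFS ⟨G.edgeFinset.card, G.maxDegree, k, f, l⟩) port crash start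
          (C * ((f + l) * min G.edgeFinset.card (min (k * G.maxDegree) (k ^ 2)))) ∧
        (Dispersion.clusterDFS ⟨G.edgeFinset.card, G.maxDegree, k, f, l⟩).memoryBits ≤
          C * (Nat.log 2 (k + G.maxDegree) + 1) := by
  -- The constant 20 is dictated by the memory bound; for the running time 8 would do.
  refine ⟨20, fun V _ _ G _ port k f l start crash hG hk hf hl hcrash => ⟨?_, ?_⟩⟩
  · refine Dispersion.dispersed (P := ⟨G.edgeFinset.card, G.maxDegree, k, f, l⟩) rfl rfl hG hk hl.le
      hcrash ?_
    show (l + f) * (8 * min G.edgeFinset.card (min (k * G.maxDegree) (k ^ 2))) ≤ _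
    nlinarith [Nat.zero_le ((f + l) * min G.edgeFinset.card (min (k * G.maxDegree) (k ^ 2)))]
  · refine Dispersion.memoryBits_le (P := ⟨G.edgeFinset.card, G.maxDegree, k, f, l⟩) ?_ hf
    show l ≤ k
    rw [← hl]
    exact Finset.card_image_le.trans (by simp)
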